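/- Let ZF be Zermelo–Fraenkel set theory, in classical first-order logic with equality over the language with one binary relation symbol $\in$; its axioms are extensionality, separation (schema), pairing, union, power set, replacement (schema), infinity and foundation. The *syntactic category* $\mathbb{ZF}$ has as objects the formulas in context $\{x_1,\dots,x_n\mid P\}$ ($n\ge 0$, all free variables of $P$ among $x_1,\dots,x_n$). An arrow $\{\mathbf x\mid P\}\to\{\mathbf y\mid Q\}$ is a class $[\{\mathbf x,\mathbf y\mid F\}]$ of formulas $F(\mathbf x,\mathbf y)$ such that $F\vdash_{ZF}P(\mathbf x)\wedge Q(\mathbf y)$, $F(\mathbf x,\mathbf y)\wedge F(\mathbf x,\mathbf y')\vdash_{ZF}\mathbf y=\mathbf y'$ and $P\vdash_{ZF}\exists\mathbf y\,F$, where $F$ and $F'$ are identified when $\vdash_{ZF}F\leftrightarrow F'$; the composite of $[F(\mathbf x,\mathbf y)]$ and $[G(\mathbf y,\mathbf z)]$ is $[\exists\mathbf y\,(F\wedge G)]$. Formulas are taken up to renaming of variables. Let $\mathbb{DCL}[ZF]$ be the full subcategory of $\mathbb{ZF}$ on the objects $\{x\mid P\}$ with one variable, and let $\mathbb{DST}[ZF]$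 be the full subcategory of $\mathbb{DCL}[ZF]$ on those $\{x\mid P\}$ with $\vdash_{ZF}\exists z\,\forall x\,(x\in z\leftrightarrow P)$. **Theorem.** $\mathbb{DST}[ZF]$ is an elementary topos: it has all finite limits, is cartesian closed, and has a subobject classifier. More precisely, writing $\langle x,y\rangle=\{\{x\},\{x,y\}\}$, the objects and arrows named below exist in $\mathbb{DST}[ZF]$, and: 1. The inclusion $\mathbb{DST}[ZF]\to\mathbb{ZF}$ preserves finite limits, and $\{x\mid x=0\}$ is a terminal object of $\mathbb{DST}[ZF]$. 2. A product of $\{x\mid P\}$ and $\{y\mid Q\}$ is $\{z\mid\exists x\exists y(z=\langle x,y\rangle\wedge P(x)\wedge Q(y))\}$, with projections the classes of $\exists x\exists y(z=\langle x,y\rangle\wedge P(x)\wedge Q(y)\wedge x'=x)$ and $\exists x\exists y(z=\langle x,y\rangle\wedge P(x)\wedge Q(y)\wedge y'=y)$. 3. The arrow $[\{x,x'\mid x=0\wedge x'=1\}]:\{x\mid x=0\}\to\{x\mid x=0\vee x=1\}$ is a subobject classifier both in $\mathbb{DST}[ZF]$ and in $\mathbb{ZF}$. 4. An exponential $\{y\mid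 Q\}^{\{x\mid P\}}$ is $\{f\mid E(f)\}$, where $E(f)$ is the formula $$\mathrm{Fun}(f)\wedge\forall s\,(s\in\mathrm{dom}(f)\leftrightarrow P(s))\wedge\forall s'\,(s'\in\mathrm{ran}(f)\rightarrow Q(s'))$$ and $\mathrm{Fun}(f)$ says that $f$ is a single-valued set of ordered pairs. Its evaluation arrow, defined on the product of $\{f\mid E\}$ and $\{x\mid P\}$ given in 2, is the class of $\exists f\exists x\,(z=\langle f,x\rangle\wedge E(f)\wedge\langle x,y\rangle\in f)$, in the variables $z,y$. -/

import Mathlib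

open CategoryTheory CategoryTheory.Limits FirstOrder FirstOrder.Language

namespace DefinableSets

/-! ### The first-order language of set theory and its formulas -/

/-- The only non-logical symbol of the language: a binary relation symbol. -/
inductive SetRel : ℕ → Type
  | mem : SetRel 2

/-- The first-order language of set theory: no function symbols and one binary relation symbol. -/
def setLang : Language := ⟨fun _ => Empty, SetRel⟩

/-- Formulas of set theory in the context `x₀, …, xₙ₋₁`. A quantifier binds the variable `xₙ`
of a formula in the context `x₀, …, xₙ`. -/
abbrev Fml (n : ℕ) := setLang.BoundedFormula Empty n

/-- The formula `xᵢ ∈ xⱼ`. -/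
def memF {n : ℕ} (i j : Fin n) : Fml n :=
  Relations.boundedFormula₂ (L := setLang) SetRel.mem (&i) (&j)

/-- The formula `xᵢ = xⱼ`. -/
def eqF {n : ℕ} (i j : Fin n) : Fml n :=
  Term.bdEqual (L := setLang) (&i) (&j)

/-- A renaming of variables, extended to a context with one more (bound) variable. -/
def liftVar {n m : ℕ} (σ : Fin n → Fin m) : Fin (n + 1) → Fin (m + 1) :=
  Fin.snoc (fun i => (σ i).castSucc) (Fin.last m)

/-- Simultaneous capture-avoiding substitution of the variable `x_{σ i}` for the free variable
`xᵢ`. (The only terms of the language are variables.) -/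
def ren : ∀ {n m : ℕ}, (Fin n → Fin m) → Fml n → Fml m
  | _, _, _, .falsum => .falsum
  | _, _, σ, .equal t s => .equal (t.relabel (Sum.map id σ)) (s.relabel (Sum.map id σ))
  | _, _, σ, .rel R ts => .rel R (fun i => (ts i).relabel (Sum.map id σ))
  | _, _, σ, .imp φ ψ => .imp (ren σ φ) (ren σ ψ)
  | _, _, σ, .all φ => .all (ren (liftVar σ) φ)

/-- `φ` regarded as a formula in a context with one more variable. -/
def weaken {n : ℕ} (φ : Fml n) : Fml (n + 1) := ren Fin.castSucc φ

/-- `φ[xᵢ/xₙ]`, for `φ` in the context `x₀, …, xₙ`. -/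
def inst {n : ℕ} (φ : Fml (n + 1)) (i : Fin n) : Fml n :=
  ren (Fin.snoc (α := fun _ => Fin n) id i) φ

/-- Existential quantification over the last `m` variables of the context. -/
def exN {n : ℕ} : ∀ m : ℕ, Fml (n + m) → Fml n
  | 0, φ => φ
  | m + 1, φ => exN m (BoundedFormula.ex (n := n + m) φ)

/-- The conjunction of the equations `x_{u i} = x_{v i}`. -/
def eqs {k n : ℕ} (u v : Fin k → Fin n) : Fml n :=
  ((List.finRange k).map fun i => eqF (u i) (v i)).foldr (· ⊓ ·) ⊤

/-! ### Derivability -/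

/-- Classical first-order natural deduction with equality: `Derives T Γ φ` says that `φ` is
derivable from the axioms `T` and the assumptions `Γ`, in the context `x₀, …, xₙ₋₁`. -/
inductive Derives (T : setLang.Theory) : ∀ {n : ℕ}, Set (Fml n) → Fml n → Prop
  | ax {n : ℕ} {Γ : Set (Fml n)} (σ : setLang.Sentence) (h : σ ∈ T) :
      Derives T Γ (ren (n := 0) Fin.elim0 σ)
  | hyp {n : ℕ} {Γ : Set (Fml n)} {φ : Fml n} (h : φ ∈ Γ) : Derives T Γ φ
  | impI {n : ℕ} {Γ : Set (Fml n)} {φ ψ : Fml n} (h : Derives T (insert φ Γ) ψ) :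
      Derives T Γ (φ ⟹ ψ)
  | impE {n : ℕ} {Γ : Set (Fml n)} {φ ψ : Fml n} (h : Derives T Γ (φ ⟹ ψ))
      (h' : Derives T Γ φ) : Derives T Γ ψ
  | byContra {n : ℕ} {Γ : Set (Fml n)} {φ : Fml n} (h : Derives T (insert (∼φ) Γ) ⊥) :
      Derives T Γ φ
  | allI {n : ℕ} {Γ : Set (Fml n)} {φ : Fml (n + 1)} (h : Derives T (weaken '' Γ) φ) :
      Derives T Γ (∀' φ)
  | allE {n : ℕ} {Γ : Set (Fml n)} {φ : Fml (n + 1)} (h : Derives T Γ (∀' φ)) (i : Fin n) :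
      Derives T Γ (inst φ i)
  | eqI {n : ℕ} {Γ : Set (Fml n)} (i : Fin n) : Derives T Γ (eqF i i)
  | eqE {n : ℕ} {Γ : Set (Fml n)} (φ : Fml (n + 1)) {i j : Fin n} (h : Derives T Γ (eqF i j))
      (h' : Derives T Γ (inst φ i)) : Derives T Γ (inst φ j)
  /-- The universe of discourse is not empty. -/
  | nonempty {n : ℕ} {Γ : Set (Fml n)} :
      Derives T Γ (∃' (eqF (Fin.last n) (Fin.last n)))

/-! #### Basic facts about renaming and derivability -/

theorem liftVar_comp {n m k : ℕ} (σ : Fin n → Fin m) (τ : Fin m → Fin k) :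
    liftVar (τ ∘ σ) = liftVar τ ∘ liftVar σ := by
  funext i
  refine Fin.lastCases ?_ (fun i => ?_) i <;> simp [liftVar]

theorem liftVar_id {n : ℕ} : liftVar (id : Fin n → Fin n) = id := by
  funext i
  refine Fin.lastCases ?_ (fun i => ?_) i <;> simp [liftVar]

theorem ren_ren {n m k : ℕ} (σ : Fin n → Fin m) (τ : Fin m → Fin k) (φ : Fml n) :
    ren τ (ren σ φ) = ren (τ ∘ σ) φ := by
  induction φ generalizing m k with
  | falsum => rfl
  | equal t s => simp [ren, Term.relabel_relabel, Sum.map_comp_map]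
  | rel R ts => simp [ren, Term.relabel_relabel, Sum.map_comp_map]
  | imp φ ψ h1 h2 => simp [ren, h1, h2]
  | all φ h => simp [ren, h, liftVar_comp]

theorem ren_id {n : ℕ} (φ : Fml n) : ren id φ = φ := by
  induction φ with
  | falsum => rfl
  | equal t s => simp [ren]
  | rel R ts => simp [ren]
  | imp φ ψ h1 h2 => simp [ren, h1, h2]
  | all φ h => simp [ren, h, liftVar_id]

theorem ren_and {n m : ℕ} (σ : Fin n → Fin m) (φ ψ : Fml n) :
    ren σ (φ ⊓ ψ) = ren σ φ ⊓ ren σ ψ := rfl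

theorem ren_not {n m : ℕ} (σ : Fin n → Fin m) (φ : Fml n) : ren σ (∼φ) = ∼(ren σ φ) := rfl

theorem ren_iff {n m : ℕ} (σ : Fin n → Fin m) (φ ψ : Fml n) :
    ren σ (φ ⇔ ψ) = (ren σ φ ⇔ ren σ ψ) := rfl

theorem ren_ex {n m : ℕ} (σ : Fin n → Fin m) (φ : Fml (n + 1)) :
    ren σ (∃' φ) = ∃' (ren (liftVar σ) φ) := rfl

theorem ren_eqF {n m : ℕ} (σ : Fin n → Fin m) (i j : Fin n) :
    ren σ (eqF i j) = eqF (σ i) (σ j) := rfl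

theorem ren_eqs {k n m : ℕ} (σ : Fin n → Fin m) (u v : Fin k → Fin n) :
    ren σ (eqs u v) = eqs (σ ∘ u) (σ ∘ v) := by
  unfold eqs
  induction List.finRange k with
  | nil => rfl
  | cons a l ih => simp only [List.map_cons, List.foldr_cons, ren_and, ih]; rfl

theorem ren_exN {n N : ℕ} (σ : Fin n → Fin N) (m : ℕ) (φ : Fml (n + m)) :
    ren σ (exN m φ) = exN m (ren (Fin.append (Fin.castAdd m ∘ σ) (Fin.natAdd N)) φ) := by
  induction m with
  | zero =>
    simp only [exN]
    congr 1
    funext i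
    exact (Fin.append_left (Fin.castAdd 0 ∘ σ) (Fin.natAdd N) i).symm
  | succ m ih =>
    simp only [exN, ih, ren_ex]
    congr 3
    funext i
    refine Fin.lastCases ?_ (fun i => ?_) i
    · simp only [liftVar, Fin.snoc_last]
      exact (Fin.append_right (Fin.castAdd (m + 1) ∘ σ) (Fin.natAdd N) (Fin.last m)).symm
    · simp only [liftVar, Fin.snoc_castSucc]
      refine Fin.addCases (fun i => ?_) (fun i => ?_) i
      · rw [Fin.append_left]
        exact (Fin.append_left (Fin.castAdd (m + 1) ∘ σ) (Fin.natAdd N) i).symm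
      · rw [Fin.append_right]
        exact (Fin.append_right (Fin.castAdd (m + 1) ∘ σ) (Fin.natAdd N) i.castSucc).symm

theorem ren_weaken {n m : ℕ} (σ : Fin n → Fin m) (φ : Fml n) :
    ren (liftVar σ) (weaken φ) = weaken (ren σ φ) := by
  simp only [weaken, ren_ren]
  congr 1
  funext i
  simp [liftVar]

theorem ren_inst {n m : ℕ} (σ : Fin n → Fin m) (φ : Fml (n + 1)) (i : Fin n) :
    ren σ (inst φ i) = inst (ren (liftVar σ) φ) (σ i) := by
  simp only [inst, ren_ren]
  congr 1
  funext j
  refine Fin.lastCases ?_ (fun j => ?_) j <;> simp [liftVar]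

theorem Derives.rename {T : setLang.Theory} {n : ℕ} {Δ : Set (Fml n)} {φ : Fml n}
    (h : Derives T Δ φ) {m : ℕ} (σ : Fin n → Fin m) {Γ : Set (Fml m)}
    (hΓ : ∀ δ ∈ Δ, ren σ δ ∈ Γ) : Derives T Γ (ren σ φ) := by
  induction h generalizing m with
  | ax τ hτ =>
    rw [ren_ren, show σ ∘ Fin.elim0 = Fin.elim0 from funext fun i => i.elim0]
    exact .ax τ hτ
  | hyp h => exact .hyp (hΓ _ h)
  | impI h ih =>
    refine .impI (ih σ fun δ hδ => ?_)
    rcases hδ with rfl | hδ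
    · exact Or.inl rfl
    · exact Or.inr (hΓ _ hδ)
  | impE h h' ih ih' => exact .impE (ih σ hΓ) (ih' σ hΓ)
  | byContra h ih =>
    refine .byContra (ih σ fun δ hδ => ?_)
    rcases hδ with rfl | hδ
    · exact Or.inl rfl
    · exact Or.inr (hΓ _ hδ)
  | allI h ih =>
    refine .allI (ih (liftVar σ) ?_)
    rintro _ ⟨δ, hδ, rfl⟩
    exact ⟨_, hΓ δ hδ, (ren_weaken σ δ).symm⟩
  | allE h i ih =>
    rw [ren_inst]
    exact .allE (ih σ hΓ) (σ i)
  | eqI i => exact .eqI (σ i)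
  | eqE φ h h' ih ih' =>
    rw [ren_inst]
    refine .eqE _ (ih σ hΓ) ?_
    rw [← ren_inst]
    exact ih' σ hΓ
  | nonempty =>
    have := @Derives.nonempty T m Γ
    rw [ren_ex, ren_eqF]
    simpa [liftVar] using this

theorem Derives.mono {T : setLang.Theory} {n : ℕ} {Δ Γ : Set (Fml n)} {φ : Fml n}
    (h : Derives T Δ φ) (hΓ : Δ ⊆ Γ) : Derives T Γ φ := by
  have := h.rename id (Γ := Γ) (fun δ hδ => by rw [ren_id]; exact hΓ hδ)
  rwa [ren_id] at this

theorem Derives.subst {T : setLang.Theory} {n : ℕ} {Δ : Set (Fml n)} {φ : Fml n}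
    (h : Derives T Δ φ) {m : ℕ} (σ : Fin n → Fin m) {Γ : Set (Fml m)}
    (hΓ : ∀ δ ∈ Δ, Derives T Γ (ren σ δ)) : Derives T Γ (ren σ φ) := by
  induction h generalizing m with
  | ax τ hτ =>
    rw [ren_ren, show σ ∘ Fin.elim0 = Fin.elim0 from funext fun i => i.elim0]
    exact .ax τ hτ
  | hyp h => exact hΓ _ h
  | impI h ih =>
    refine .impI (ih σ fun δ hδ => ?_)
    rcases hδ with rfl | hδ
    · exact .hyp (Or.inl rfl)
    · exact (hΓ _ hδ).mono (Set.subset_insert _ _)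
  | impE h h' ih ih' => exact .impE (ih σ hΓ) (ih' σ hΓ)
  | byContra h ih =>
    refine .byContra (ih σ fun δ hδ => ?_)
    rcases hδ with rfl | hδ
    · exact .hyp (Or.inl rfl)
    · exact (hΓ _ hδ).mono (Set.subset_insert _ _)
  | allI h ih =>
    refine .allI (ih (liftVar σ) ?_)
    rintro _ ⟨δ, hδ, rfl⟩
    rw [ren_weaken]
    exact (hΓ δ hδ).rename _ fun γ hγ => ⟨γ, hγ, rfl⟩
  | allE h i ih =>
    rw [ren_inst]
    exact .allE (ih σ hΓ) (σ i)
  | eqI i => exact .eqI (σ i)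
  | eqE φ h h' ih ih' =>
    rw [ren_inst]
    refine .eqE _ (ih σ hΓ) ?_
    rw [← ren_inst]
    exact ih' σ hΓ
  | nonempty =>
    have := @Derives.nonempty T m Γ
    rw [ren_ex, ren_eqF]
    simpa [liftVar] using this

section Rules

variable {T : setLang.Theory} {n : ℕ} {Γ : Set (Fml n)}

/-- An entailment between formulas in the same context, applied under a substitution. -/
theorem Derives.app {k : ℕ} {φ ψ : Fml k} (h : Derives T {φ} ψ) (v : Fin k → Fin n)
    (h' : Derives T Γ (ren v φ)) : Derives T Γ (ren v ψ) :=
  h.subst v (by rintro _ rfl; exact h')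

theorem Derives.cut {φ ψ : Fml n} (h' : Derives T Γ φ) (h : Derives T (insert φ Γ) ψ) :
    Derives T Γ ψ :=
  .impE (.impI h) h'

theorem Derives.exfalso {φ : Fml n} (h : Derives T Γ ⊥) : Derives T Γ φ :=
  .byContra (h.mono (Set.subset_insert _ _))

theorem Derives.andI {φ ψ : Fml n} (h : Derives T Γ φ) (h' : Derives T Γ ψ) :
    Derives T Γ (φ ⊓ ψ) := by
  refine .impI (.impE (φ := ψ) (.impE (φ := φ) (.hyp (Or.inl rfl)) ?_) ?_)
  · exact h.mono (Set.subset_insert _ _)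
  · exact h'.mono (Set.subset_insert _ _)

theorem Derives.andE_left {φ ψ : Fml n} (h : Derives T Γ (φ ⊓ ψ)) : Derives T Γ φ := by
  refine .byContra (.impE (φ := φ ⟹ ∼ψ) (h.mono (Set.subset_insert _ _)) (.impI ?_))
  exact .exfalso (.impE (φ := φ) (.hyp (Or.inr (Or.inl rfl))) (.hyp (Or.inl rfl)))

theorem Derives.andE_right {φ ψ : Fml n} (h : Derives T Γ (φ ⊓ ψ)) : Derives T Γ ψ := by
  refine .byContra (.impE (φ := φ ⟹ ∼ψ) (h.mono (Set.subset_insert _ _)) (.impI ?_))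
  exact .hyp (Or.inr (Or.inl rfl))

theorem Derives.iffI {φ ψ : Fml n} (h : Derives T (insert φ Γ) ψ)
    (h' : Derives T (insert ψ Γ) φ) : Derives T Γ (φ ⇔ ψ) :=
  .andI (.impI h) (.impI h')

theorem Derives.iff_mp {φ ψ : Fml n} (h : Derives T Γ (φ ⇔ ψ)) (h' : Derives T Γ φ) :
    Derives T Γ ψ := .impE (.andE_left h) h'

theorem Derives.iff_mpr {φ ψ : Fml n} (h : Derives T Γ (φ ⇔ ψ)) (h' : Derives T Γ ψ) :
    Derives T Γ φ := .impE (.andE_right h) h'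

theorem Derives.exI {φ : Fml (n + 1)} (i : Fin n) (h : Derives T Γ (inst φ i)) :
    Derives T Γ (∃' φ) := by
  refine .impI (.impE (φ := inst φ i) ?_ (h.mono (Set.subset_insert _ _)))
  exact .allE (φ := ∼φ) (.hyp (Or.inl rfl)) i

theorem Derives.exE {φ : Fml (n + 1)} {ψ : Fml n} (h : Derives T Γ (∃' φ))
    (h' : Derives T (insert φ (weaken '' Γ)) (weaken ψ)) : Derives T Γ ψ := by
  refine .byContra (.impE (φ := ∀' (∼φ)) (h.mono (Set.subset_insert _ _)) (.allI (.impI ?_)))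
  refine .impE (φ := weaken ψ) (.hyp (Or.inr ⟨_, Or.inl rfl, rfl⟩)) (h'.mono ?_)
  exact Set.insert_subset_insert (Set.image_mono (Set.subset_insert _ _))

theorem Derives.exNI {m : ℕ} {φ : Fml (n + m)} (y : Fin m → Fin n)
    (h : Derives T Γ (ren (Fin.append id y) φ)) : Derives T Γ (exN m φ) := by
  induction m with
  | zero =>
    have : Fin.append id y = (id : Fin n → Fin n) :=
      funext fun i => Fin.append_left (id : Fin n → Fin n) y i
    rw [this] at h
    exact (ren_id φ) ▸ h
  | succ m ih =>
    refine ih (y ∘ Fin.castSucc) ?_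
    rw [ren_ex]
    refine .exI (y (Fin.last m)) ?_
    rw [inst, ren_ren]
    have e : (Fin.snoc (α := fun _ => Fin n) id (y (Fin.last m)) ∘
        liftVar (Fin.append id (y ∘ Fin.castSucc)) : Fin (n + m + 1) → Fin n) =
        Fin.append (n := m + 1) id y := by
      funext i
      refine Fin.lastCases ?_ (fun i => ?_) i
      · simp only [liftVar, Function.comp, Fin.snoc_last]
        exact (Fin.append_right (id : Fin n → Fin n) y (Fin.last m)).symm
      · simp only [liftVar, Function.comp, Fin.snoc_castSucc]
        refine Fin.addCases (fun i => ?_) (fun i => ?_) i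
        · rw [Fin.append_left]
          exact (Fin.append_left (id : Fin n → Fin n) y i).symm
        · rw [Fin.append_right]
          exact (Fin.append_right (id : Fin n → Fin n) y i.castSucc).symm
    exact e ▸ h

theorem Derives.exNE {m : ℕ} {φ : Fml (n + m)} {ψ : Fml n} (h : Derives T Γ (exN m φ))
    (h' : Derives T (insert φ (ren (Fin.castAdd m) '' Γ)) (ren (Fin.castAdd m) ψ)) :
    Derives T Γ ψ := by
  induction m with
  | zero =>
    refine .cut h ?_
    have e : (Fin.castAdd 0 : Fin n → Fin n) = id := rfl
    have e' : ren (Fin.castAdd 0 : Fin n → Fin n) = id := by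
      funext φ; rw [e, ren_id]; rfl
    have h'' : Derives T (insert φ (ren (Fin.castAdd 0 : Fin n → Fin n) '' Γ))
      (ren (Fin.castAdd 0 : Fin n → Fin n) ψ) := h'
    rw [e', Set.image_id] at h''
    exact h''
  | succ m ih =>
    refine ih h (.exE (.hyp (Or.inl rfl)) ?_)
    have e : ∀ χ : Fml n, weaken (ren (Fin.castAdd m) χ) = ren (Fin.castAdd (m + 1)) χ := by
      intro χ; rw [weaken, ren_ren]; rfl
    rw [e]
    refine h'.mono (Set.insert_subset_insert ?_)
    rintro _ ⟨χ, hχ, rfl⟩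
    exact ⟨_, Or.inr ⟨χ, hχ, rfl⟩, e χ⟩

theorem Derives.eqsI {k : ℕ} {u v : Fin k → Fin n} (h : ∀ i, Derives T Γ (eqF (u i) (v i))) :
    Derives T Γ (eqs u v) := by
  unfold eqs
  induction List.finRange k with
  | nil => exact .impI (.hyp (Or.inl rfl))
  | cons a l ih => exact .andI (h a) ih

theorem Derives.eqsE {k : ℕ} {u v : Fin k → Fin n} (h : Derives T Γ (eqs u v)) (i : Fin k) :
    Derives T Γ (eqF (u i) (v i)) := by
  unfold eqs at h
  have hi := List.mem_finRange i
  revert h hi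
  induction List.finRange k with
  | nil => simp
  | cons a l ih =>
    intro h hi
    rcases List.mem_cons.1 hi with rfl | hi
    · exact h.andE_left
    · exact ih h.andE_right hi

theorem Derives.eqSymm {i j : Fin n} (h : Derives T Γ (eqF i j)) : Derives T Γ (eqF j i) := by
  have := Derives.eqE (T := T) (Γ := Γ) (eqF (Fin.last n) i.castSucc) h
    (by simpa [inst, ren_eqF] using Derives.eqI i)
  simpa [inst, ren_eqF] using this

theorem Derives.eqTrans {i j k : Fin n} (h : Derives T Γ (eqF i j)) (h' : Derives T Γ (eqF j k)) :
    Derives T Γ (eqF i k) := by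
  have := Derives.eqE (T := T) (Γ := Γ) (eqF i.castSucc (Fin.last n)) h'
    (by simpa [inst, ren_eqF] using h)
  simpa [inst, ren_eqF] using this

/-- Simultaneous replacement of equals by equals. -/
theorem Derives.replace {k : ℕ} {φ : Fml k} {u v : Fin k → Fin n}
    (h : ∀ i, Derives T Γ (eqF (u i) (v i))) (h' : Derives T Γ (ren u φ)) :
    Derives T Γ (ren v φ) := by
  have key : ∀ s : Finset (Fin k), Derives T Γ (ren (fun i => if i ∈ s then v i else u i) φ) := by
    intro s
    induction s using Finset.induction_on with
    | empty => simpa using h'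
    | insert a s ha ih =>
      have e : ∀ c : Fin n, inst (ren (fun i => if i = a then Fin.last n else
          (if i ∈ s then v i else u i).castSucc) φ) c =
          ren (fun i => if i = a then c else if i ∈ s then v i else u i) φ := by
        intro c
        rw [inst, ren_ren]
        congr 1
        funext i
        by_cases hi : i = a <;> simp [hi]
      have := Derives.eqE (T := T) (Γ := Γ) (ren (fun i => if i = a then Fin.last n else
          (if i ∈ s then v i else u i).castSucc) φ) (h a) (by
        rw [e]
        convert ih using 2
        funext i
        by_cases hi : i = a
        · subst hi; simp [ha]
        · simp [hi])
      rw [e] at this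
      convert this using 2
      funext i
      by_cases hi : i = a <;> simp [hi]
  simpa using key Finset.univ

end Rules

/-! ### The syntactic category -/

/-- A formula in context `{x₀, …, xₙ₋₁ | P}`, as an object of the syntactic category of `T`. -/
structure SynCat (T : setLang.Theory) where
  arity : ℕ
  formula : Fml arity

namespace SynCat

variable {T : setLang.Theory}

/-- The formula `F(x, y)` in the context `x, y` is provably the graph of a function from
`{x | P}` to `{y | Q}`. -/
structure IsFunctional (X Y : SynCat T) (F : Fml (X.arity + Y.arity)) : Prop where
  /-- `F(x, y) ⊢ P(x) ∧ Q(y)`. -/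
  typed : Derives T {F} (ren (Fin.castAdd Y.arity) X.formula ⊓ ren (Fin.natAdd X.arity) Y.formula)
  /-- `F(x, y) ∧ F(x, y') ⊢ y = y'`, in the context `x, y, y'`. -/
  unique : Derives T
    {ren (Fin.castAdd Y.arity) F ⊓
      ren (Fin.append (Fin.castAdd Y.arity ∘ Fin.castAdd Y.arity)
        (Fin.natAdd (X.arity + Y.arity))) F}
    (eqs (Fin.castAdd Y.arity ∘ Fin.natAdd X.arity) (Fin.natAdd (X.arity + Y.arity)))
  /-- `P(x) ⊢ ∃ y, F(x, y)`. -/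
  total : Derives T {X.formula} (exN Y.arity F)

/-- Provably functional formulas from `X` to `Y`. -/
def FunRel (X Y : SynCat T) := {F : Fml (X.arity + Y.arity) // IsFunctional X Y F}

/-- `F ≡ F'` if and only if `T` proves `F ↔ F'`. -/
instance funRelSetoid (X Y : SynCat T) : Setoid (FunRel X Y) where
  r F F' := Derives T ∅ (F.1 ⇔ F'.1)
  iseqv :=
    { refl := fun _ => .iffI (.hyp (Or.inl rfl)) (.hyp (Or.inl rfl))
      symm := fun h => .andI h.andE_right h.andE_left
      trans := fun h h' =>
        .iffI
          (.iff_mp (h'.mono (Set.empty_subset _)) (.iff_mp (h.mono (Set.empty_subset _))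
            (.hyp (Or.inl rfl))))
          (.iff_mpr (h.mono (Set.empty_subset _)) (.iff_mpr (h'.mono (Set.empty_subset _))
            (.hyp (Or.inl rfl)))) }

/-- The formula `x = x' ∧ P(x)`, in the context `x, x'`. -/
def idFml (X : SynCat T) : Fml (X.arity + X.arity) :=
  eqs (Fin.castAdd X.arity) (Fin.natAdd X.arity) ⊓ ren (Fin.castAdd X.arity) X.formula

/-- The formula `∃ y, F(x, y) ∧ G(y, z)`, in the context `x, z`. -/
def compFml {n m k : ℕ} (F : Fml (n + m)) (G : Fml (m + k)) : Fml (n + k) :=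
  exN m
    (ren (Fin.append (Fin.castAdd m ∘ Fin.castAdd k) (Fin.natAdd (n + k))) F ⊓
      ren (Fin.append (Fin.natAdd (n + k)) (Fin.castAdd m ∘ Fin.natAdd n)) G)

/-! #### The functionality conditions at arbitrary tuples of variables -/

theorem comp_append {n m N M : ℕ} (f : Fin N → Fin M) (x : Fin n → Fin N) (y : Fin m → Fin N) :
    f ∘ Fin.append x y = Fin.append (f ∘ x) (f ∘ y) := by
  funext i
  refine Fin.addCases (fun i => ?_) (fun i => ?_) i <;> simp

theorem append_comp_castAdd {n m N : ℕ} (x : Fin n → Fin N) (y : Fin m → Fin N) :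
    Fin.append x y ∘ Fin.castAdd m = x := by
  funext i; simp

theorem append_comp_natAdd {n m N : ℕ} (x : Fin n → Fin N) (y : Fin m → Fin N) :
    Fin.append x y ∘ Fin.natAdd n = y := by
  funext i; simp

theorem append_castAdd_natAdd {n m : ℕ} :
    Fin.append (Fin.castAdd m) (Fin.natAdd n) = (id : Fin (n + m) → Fin (n + m)) := by
  funext i
  refine Fin.addCases (fun i => ?_) (fun i => ?_) i <;> simp

section Pointwise

variable {X Y : SynCat T} {F : Fml (X.arity + Y.arity)} {N : ℕ} {Γ : Set (Fml N)}
  {x : Fin X.arity → Fin N} {y y' : Fin Y.arity → Fin N}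

theorem IsFunctional.dom (h : IsFunctional X Y F) (hF : Derives T Γ (ren (Fin.append x y) F)) :
    Derives T Γ (ren x X.formula) := by
  have := (h.typed.app _ hF).andE_left
  rwa [ren_ren, append_comp_castAdd] at this

theorem IsFunctional.cod (h : IsFunctional X Y F) (hF : Derives T Γ (ren (Fin.append x y) F)) :
    Derives T Γ (ren y Y.formula) := by
  have := (h.typed.app _ hF).andE_right
  rwa [ren_ren, append_comp_natAdd] at this

theorem IsFunctional.eq (h : IsFunctional X Y F) (hF : Derives T Γ (ren (Fin.append x y) F))
    (hF' : Derives T Γ (ren (Fin.append x y') F)) (i : Fin Y.arity) :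
    Derives T Γ (eqF (y i) (y' i)) := by
  have := (h.unique.app (Fin.append (Fin.append x y) y') (Γ := Γ) (by
    rw [ren_and, ren_ren, ren_ren, comp_append, append_comp_natAdd, ← Function.comp_assoc,
      append_comp_castAdd, append_comp_castAdd]
    exact .andI hF hF'))
  rw [ren_eqs, append_comp_natAdd, ← Function.comp_assoc, append_comp_castAdd,
    append_comp_natAdd] at this
  exact this.eqsE i

theorem IsFunctional.exists (h : IsFunctional X Y F) (hX : Derives T Γ (ren x X.formula)) :
    Derives T Γ (exN Y.arity (ren (Fin.append (Fin.castAdd Y.arity ∘ x) (Fin.natAdd N)) F)) := by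
  rw [← ren_exN]
  exact h.total.app x hX

end Pointwise

/-- Introduction rule for the formula `∃ y, F(x, y) ∧ G(y, z)`. -/
theorem compFml_intro {n m k N : ℕ} {Γ : Set (Fml N)} {F : Fml (n + m)} {G : Fml (m + k)}
    {x : Fin n → Fin N} {z : Fin k → Fin N} (y : Fin m → Fin N)
    (hF : Derives T Γ (ren (Fin.append x y) F)) (hG : Derives T Γ (ren (Fin.append y z) G)) :
    Derives T Γ (ren (Fin.append x z) (compFml F G)) := by
  rw [compFml, ren_exN]
  refine .exNI y ?_
  simp only [ren_and, ren_ren, comp_append, ← Function.comp_assoc, append_comp_castAdd,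
    append_comp_natAdd, Function.id_comp]
  exact .andI hF hG

/-- Elimination rule for the formula `∃ y, F(x, y) ∧ G(y, z)`. -/
theorem compFml_elim {n m k N : ℕ} {Γ : Set (Fml N)} {F : Fml (n + m)} {G : Fml (m + k)}
    {x : Fin n → Fin N} {z : Fin k → Fin N} {ψ : Fml N}
    (h : Derives T Γ (ren (Fin.append x z) (compFml F G)))
    (h' : ∀ (M : ℕ) (ρ : Fin N → Fin M) (Δ : Set (Fml M)), (∀ γ ∈ Γ, ren ρ γ ∈ Δ) →
      ∀ y : Fin m → Fin M, Derives T Δ (ren (Fin.append (ρ ∘ x) y) F) →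
        Derives T Δ (ren (Fin.append y (ρ ∘ z)) G) → Derives T Δ (ren ρ ψ)) :
    Derives T Γ ψ := by
  rw [compFml, ren_exN] at h
  refine h.exNE ?_
  simp only [ren_and, ren_ren, comp_append, ← Function.comp_assoc, append_comp_castAdd,
    append_comp_natAdd]
  refine .cut (.hyp (Or.inl rfl)) ?_
  refine h' _ _ _ (fun γ hγ => Or.inr (Or.inr ⟨γ, hγ, rfl⟩)) (Fin.natAdd N) ?_ ?_
  · exact (Derives.hyp (Or.inl rfl)).andE_left
  · exact (Derives.hyp (Or.inl rfl)).andE_right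

theorem IsFunctional.of_pointwise {X Y : SynCat T} {F : Fml (X.arity + Y.arity)}
    (dom : ∀ (N : ℕ) (Γ : Set (Fml N)) (x : Fin X.arity → Fin N) (y : Fin Y.arity → Fin N),
      Derives T Γ (ren (Fin.append x y) F) → Derives T Γ (ren x X.formula))
    (cod : ∀ (N : ℕ) (Γ : Set (Fml N)) (x : Fin X.arity → Fin N) (y : Fin Y.arity → Fin N),
      Derives T Γ (ren (Fin.append x y) F) → Derives T Γ (ren y Y.formula))
    (eq : ∀ (N : ℕ) (Γ : Set (Fml N)) (x : Fin X.arity → Fin N) (y y' : Fin Y.arity → Fin N),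
      Derives T Γ (ren (Fin.append x y) F) → Derives T Γ (ren (Fin.append x y') F) →
        ∀ i, Derives T Γ (eqF (y i) (y' i)))
    (total : Derives T {X.formula} (exN Y.arity F)) : IsFunctional X Y F where
  typed := by
    have h : Derives T {F} (ren (Fin.append (Fin.castAdd Y.arity) (Fin.natAdd X.arity)) F) := by
      rw [append_castAdd_natAdd, ren_id]; exact .hyp rfl
    exact .andI (dom _ _ _ _ h) (cod _ _ _ _ h)
  unique := by
    refine .eqsI (eq _ _ (Fin.castAdd Y.arity ∘ Fin.castAdd Y.arity) _ _ ?_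
      (Derives.andE_right (.hyp rfl)))
    rw [← comp_append, append_castAdd_natAdd, Function.comp_id]
    exact Derives.andE_left (.hyp rfl)
  total := total

/-- Two provably functional formulas are equivalent as soon as one entails the other. -/
theorem FunRel.equiv_of_pointwise {X Y : SynCat T} (F G : FunRel X Y)
    (h : ∀ (N : ℕ) (Γ : Set (Fml N)) (x : Fin X.arity → Fin N) (y : Fin Y.arity → Fin N),
      Derives T Γ (ren (Fin.append x y) F.1) → Derives T Γ (ren (Fin.append x y) G.1)) :
    F ≈ G := by
  refine .iffI ?_ ?_
  · have := h _ (insert F.1 ∅) (Fin.castAdd Y.arity) (Fin.natAdd X.arity) (by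
      rw [append_castAdd_natAdd, ren_id]; exact .hyp (Or.inl rfl))
    rwa [append_castAdd_natAdd, ren_id] at this
  · have hG : Derives T (insert G.1 ∅)
        (ren (Fin.append (Fin.castAdd Y.arity) (Fin.natAdd X.arity)) G.1) := by
      rw [append_castAdd_natAdd, ren_id]; exact .hyp (Or.inl rfl)
    refine (F.2.exists (G.2.dom hG)).exNE ?_
    set Δ := insert (ren (Fin.append (Fin.castAdd Y.arity ∘ Fin.castAdd Y.arity)
      (Fin.natAdd (X.arity + Y.arity))) F.1) (ren (Fin.castAdd Y.arity) '' insert G.1 ∅)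
    have hF : Derives T Δ (ren (Fin.append (Fin.castAdd Y.arity ∘ Fin.castAdd Y.arity)
      (Fin.natAdd (X.arity + Y.arity))) F.1) := .hyp (Or.inl rfl)
    have hG' : Derives T Δ (ren (Fin.append (Fin.castAdd Y.arity ∘ Fin.castAdd Y.arity)
        (Fin.castAdd Y.arity ∘ Fin.natAdd X.arity)) G.1) := by
      rw [← comp_append, append_castAdd_natAdd, Function.comp_id]
      exact .hyp (Or.inr ⟨_, Or.inl rfl, rfl⟩)
    have e := G.2.eq (h _ _ _ _ hF) hG'
    have := Derives.replace (φ := F.1) (v := Fin.append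
      (Fin.castAdd Y.arity ∘ Fin.castAdd Y.arity)
      (Fin.castAdd Y.arity ∘ Fin.natAdd X.arity)) (fun i => ?_) hF
    · rwa [← comp_append, append_castAdd_natAdd, Function.comp_id] at this
    · refine Fin.addCases (fun i => ?_) (fun i => ?_) i
      · simpa using Derives.eqI _
      · simpa using e i

theorem FunRel.pointwise_of_equiv {X Y : SynCat T} {F G : FunRel X Y} (h : F ≈ G)
    {N : ℕ} {Γ : Set (Fml N)} {x : Fin X.arity → Fin N} {y : Fin Y.arity → Fin N}
    (hF : Derives T Γ (ren (Fin.append x y) F.1)) :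
    Derives T Γ (ren (Fin.append x y) G.1) := by
  have h' : Derives T ∅ (F.1 ⇔ G.1) := h
  have := h'.subst (Fin.append x y) (Γ := Γ) (by simp)
  exact .iff_mp this hF

theorem idFml_iff {X : SynCat T} {N : ℕ} {Γ : Set (Fml N)} {x y : Fin X.arity → Fin N} :
    Derives T Γ (ren (Fin.append x y) (idFml X)) ↔
      (∀ i, Derives T Γ (eqF (x i) (y i))) ∧ Derives T Γ (ren x X.formula) := by
  rw [idFml, ren_and, ren_eqs, ren_ren, append_comp_castAdd, append_comp_natAdd]
  exact ⟨fun h => ⟨h.andE_left.eqsE, h.andE_right⟩, fun h => .andI (.eqsI h.1) h.2⟩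

theorem isFunctional_id (X : SynCat T) : IsFunctional X X (idFml X) := by
  refine .of_pointwise (fun N Γ x y h => (idFml_iff.1 h).2)
    (fun N Γ x y h => .replace (idFml_iff.1 h).1 (idFml_iff.1 h).2)
    (fun N Γ x y y' h h' i => .eqTrans (.eqSymm ((idFml_iff.1 h).1 i)) ((idFml_iff.1 h').1 i)) ?_
  refine .exNI id (idFml_iff.2 ⟨fun i => .eqI i, ?_⟩)
  rw [ren_id]
  exact .hyp rfl

theorem isFunctional_comp {X Y Z : SynCat T} {F : Fml (X.arity + Y.arity)}
    {G : Fml (Y.arity + Z.arity)} (hF : IsFunctional X Y F) (hG : IsFunctional Y Z G) :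
    IsFunctional X Z (compFml F G) := by
  refine .of_pointwise (fun N Γ x z h => ?_) (fun N Γ x z h => ?_) (fun N Γ x z z' h h' i => ?_) ?_
  · refine compFml_elim h fun M ρ Δ _ y h1 h2 => ?_
    rw [ren_ren]
    exact hF.dom h1
  · refine compFml_elim h fun M ρ Δ _ y h1 h2 => ?_
    rw [ren_ren]
    exact hG.cod h2
  · refine compFml_elim h fun M ρ Δ hΔ y h1 h2 => ?_
    have h' := h'.rename ρ hΔ
    rw [ren_ren, comp_append] at h'
    refine compFml_elim h' fun M' ρ' Δ' hΔ' y' h1' h2' => ?_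
    have h1 := h1.rename ρ' hΔ'
    have h2 := h2.rename ρ' hΔ'
    rw [ren_ren, comp_append] at h1 h2
    have e := hF.eq h1 h1'
    have := Derives.replace (φ := G) (v := Fin.append y' (ρ' ∘ (ρ ∘ z))) (fun i => ?_) h2
    · exact hG.eq this h2' i
    · refine Fin.addCases (fun i => ?_) (fun i => ?_) i
      · simpa using e i
      · simpa using Derives.eqI _
  · have h : Derives T {X.formula} (ren id X.formula) := by rw [ren_id]; exact .hyp rfl
    refine (hF.exists h).exNE ?_
    refine .cut (hG.exists (x := Fin.natAdd X.arity) (hF.cod (.hyp (Or.inl rfl)))) ?_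
    rw [ren_exN]
    refine (Derives.hyp (Or.inl rfl)).exNE ?_
    rw [ren_exN]
    refine .exNI (Fin.natAdd _) ?_
    simp only [ren_ren, comp_append, ← Function.comp_assoc, append_comp_castAdd,
      append_comp_natAdd, Function.id_comp, Function.comp_id]
    refine compFml_intro (Fin.castAdd Z.arity ∘ Fin.natAdd X.arity) ?_ (.hyp (Or.inl rfl))
    refine .hyp (Or.inr ⟨_, Or.inr (Or.inl rfl), ?_⟩)
    rw [ren_ren, comp_append]

/-- The category laws hold up to provable equivalence. -/
instance : Category (SynCat T) where
  Hom X Y := Quotient (funRelSetoid X Y)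
  id X := Quotient.mk _ ⟨idFml X, isFunctional_id X⟩
  comp {X Y Z} := Quotient.map₂
    (fun F G => ⟨compFml F.1 G.1, isFunctional_comp F.2 G.2⟩)
    (fun F F' hF G G' hG => FunRel.equiv_of_pointwise _ _ fun N Γ x z h =>
      by
        have h := compFml_elim (ψ := ren (Fin.append x z) (compFml F'.1 G'.1)) h
          fun M ρ Δ _ y h1 h2 => by
            rw [ren_ren, comp_append]
            exact compFml_intro y (FunRel.pointwise_of_equiv hF h1)
              (FunRel.pointwise_of_equiv hG h2)
        exact h)
  id_comp {X Y} f := by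
    induction f using Quotient.inductionOn with | h F => ?_
    refine Quotient.sound (FunRel.equiv_of_pointwise _ _ fun N Γ x z h =>
      compFml_elim h fun M ρ Δ _ y h1 h2 => ?_)
    rw [ren_ren, comp_append]
    refine Derives.replace (fun i => ?_) h2
    refine Fin.addCases (fun i => ?_) (fun i => ?_) i
    · simpa using Derives.eqSymm ((idFml_iff.1 h1).1 i)
    · simpa using Derives.eqI _
  comp_id {X Y} f := by
    induction f using Quotient.inductionOn with | h F => ?_
    refine Quotient.sound (FunRel.equiv_of_pointwise _ _ fun N Γ x z h =>
      compFml_elim h fun M ρ Δ _ y h1 h2 => ?_)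
    rw [ren_ren, comp_append]
    refine Derives.replace (fun i => ?_) h1
    refine Fin.addCases (fun i => ?_) (fun i => ?_) i
    · simpa using Derives.eqI _
    · simpa using (idFml_iff.1 h2).1 i
  assoc {W X Y Z} f g h := by
    induction f using Quotient.inductionOn with | h F => ?_
    induction g using Quotient.inductionOn with | h G => ?_
    induction h using Quotient.inductionOn with | h H => ?_
    refine Quotient.sound (FunRel.equiv_of_pointwise _ _ fun N Γ x z h =>
      compFml_elim h fun M ρ Δ hΔ y h1 h2 => compFml_elim h1 fun M' ρ' Δ' hΔ' y' h3 h4 => ?_)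
    have h2 := h2.rename ρ' hΔ'
    rw [ren_ren, comp_append] at h2
    rw [ren_ren, ren_ren, comp_append]
    exact compFml_intro y' h3 (compFml_intro (ρ' ∘ y) h4 h2)

end SynCat

/-! ### Formulas of set theory

Variables are numbered by their position in the context: under quantifiers the free variables keep
their numbers, and the bound ones get the next numbers. Thus `ren ![2, 0] φ` is `φ(x₂, x₀)`. -/

/-- `x₀ = ∅`. -/
def emptyF : Fml 1 := ∀' ∼(memF 1 0)

/-- `x₀ = 1`, that is, `x₀ = {∅}`. -/
def oneF : Fml 1 := ∀' (memF 1 0 ⇔ ren ![1] emptyF)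

/-- `x₀ = {x₁}`. -/
def singletonF : Fml 2 := ∀' (memF 2 0 ⇔ eqF 2 1)

/-- `x₀ = {x₁, x₂}`. -/
def unorderedPairF : Fml 3 := ∀' (memF 3 0 ⇔ (eqF 3 1 ⊔ eqF 3 2))

/-- `x₀ = ⟨x₁, x₂⟩`, the Kuratowski pair `{{x₁}, {x₁, x₂}}`. -/
def pairF : Fml 3 := ∀' (memF 3 0 ⇔ (ren ![3, 1] singletonF ⊔ ren ![3, 1, 2] unorderedPairF))

/-- `⟨x₀, x₁⟩ ∈ x₂`. -/
def pairMemF : Fml 3 := ∃' (ren ![3, 0, 1] pairF ⊓ memF 3 2)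

/-- `x₀ ∈ dom(x₁)`. -/
def memDomF : Fml 2 := ∃' (ren ![0, 2, 1] pairMemF)

/-- `x₀ ∈ ran(x₁)`. -/
def memRanF : Fml 2 := ∃' (ren ![2, 0, 1] pairMemF)

/-- `Fun(x₀)`: `x₀` is a set of ordered pairs and is single-valued. -/
def funF : Fml 1 :=
  (∀' (memF 1 0 ⟹ ∃' ∃' (ren ![1, 2, 3] pairF))) ⊓
    ∀' ∀' ∀' ((ren ![1, 2, 0] pairMemF ⊓ ren ![1, 3, 0] pairMemF) ⟹ eqF 2 3)

/-! ### The axioms of ZF -/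

/-- For a formula `φ(p, v)` with parameters `p = (x₀, …, xₖ₋₁)`, the formula `φ(p, w)`, where
`w i` is the variable numbered `k + w i` of the context `x₀, …, xₖ₊ⱼ₋₁`. -/
def withParams {k l : ℕ} (j : ℕ) (w : Fin l → Fin j) (φ : Fml (k + l)) : Fml (k + j) :=
  ren (Fin.append (Fin.castAdd j) (Fin.natAdd k ∘ w)) φ

/-- The formula `xₖ₊ₐ ∈ xₖ₊ᵦ`. -/
def memP {k : ℕ} (j : ℕ) (a b : Fin j) : Fml (k + j) := memF (Fin.natAdd k a) (Fin.natAdd k b)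

/-- The formula `xₖ₊ₐ = xₖ₊ᵦ`. -/
def eqP {k : ℕ} (j : ℕ) (a b : Fin j) : Fml (k + j) := eqF (Fin.natAdd k a) (Fin.natAdd k b)

/-- `∀ x y, (∀ t, t ∈ x ↔ t ∈ y) → x = y`. -/
def extensionality : setLang.Sentence :=
  ∀' ∀' ((∀' (memF 2 0 ⇔ memF 2 1)) ⟹ eqF 0 1)

/-- `∀ p, ∀ x, ∃ y, ∀ t, t ∈ y ↔ t ∈ x ∧ P(p, t)`. -/
def separation (k : ℕ) (P : Fml (k + 1)) : setLang.Sentence :=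
  BoundedFormula.alls (n := k)
    (∀' ∃' ∀' (memP 3 2 1 ⇔ (memP 3 2 0 ⊓ withParams 3 ![2] P)))

/-- `∀ x y, ∃ z, ∀ t, t ∈ z ↔ t = x ∨ t = y`. -/
def pairing : setLang.Sentence :=
  ∀' ∀' ∃' ∀' (memF 3 2 ⇔ (eqF 3 0 ⊔ eqF 3 1))

/-- `∀ x, ∃ z, ∀ t, t ∈ z ↔ ∃ y, t ∈ y ∧ y ∈ x`. -/
def union : setLang.Sentence :=
  ∀' ∃' ∀' (memF 2 1 ⇔ ∃' (memF 2 3 ⊓ memF 3 0))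

/-- `∀ y, ∃ z, ∀ x, x ∈ z ↔ x ⊆ y`. -/
def powerset : setLang.Sentence :=
  ∀' ∃' ∀' (memF 2 1 ⇔ ∀' (memF 3 2 ⟹ memF 3 0))

/-- `∀ p, ∀ z, (∀ x ∈ z, ∃! y, F(p, x, y)) → ∃ z', ∀ x ∈ z, ∃ y ∈ z', F(p, x, y)`. -/
def replacement (k : ℕ) (F : Fml (k + 2)) : setLang.Sentence :=
  BoundedFormula.alls (n := k)
    (∀' ((∀' (memP 2 1 0 ⟹
          ∃' (withParams 3 ![1, 2] F ⊓ ∀' (withParams 4 ![1, 3] F ⟹ eqP 4 3 2)))) ⟹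
      ∃' ∀' (memP 3 2 0 ⟹ ∃' (memP 4 3 1 ⊓ withParams 4 ![2, 3] F))))

/-- `∃ x, ∅ ∈ x ∧ ∀ t ∈ x, t ∪ {t} ∈ x`. -/
def infinity : setLang.Sentence :=
  ∃' ((∃' (ren ![1] emptyF ⊓ memF 1 0)) ⊓
    ∀' (memF 1 0 ⟹ ∃' ((∀' (memF 3 2 ⇔ (memF 3 1 ⊔ eqF 3 1))) ⊓ memF 2 0)))

/-- `∀ x, x ≠ ∅ → ∃ z ∈ x, ∀ t ∈ x, t ∉ z`. -/
def foundation : setLang.Sentence :=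
  ∀' (∼(ren ![0] emptyF) ⟹ ∃' (memF 1 0 ⊓ ∀' (memF 2 0 ⟹ ∼(memF 2 1))))

/-- The axioms of Zermelo–Fraenkel set theory. -/
def ZF : setLang.Theory :=
  {extensionality, pairing, union, powerset, infinity, foundation} ∪
    {σ | ∃ (k : ℕ) (P : Fml (k + 1)), σ = separation k P} ∪
    {σ | ∃ (k : ℕ) (F : Fml (k + 2)), σ = replacement k F}

/-! ### Definable classes and definable sets -/

/-- The category of definable classes: the full subcategory of the syntactic category of ZF on the
formulas `{x | P}` in a context of length one. -/
abbrev DCL := InducedCategory (SynCat ZF) (fun P : Fml 1 => SynCat.mk 1 P)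

/-- ZF proves `∃ z, ∀ x, x ∈ z ↔ P(x)`. -/
def IsDefinableSet (P : Fml 1) : Prop :=
  Derives ZF ∅ (∃' ∀' (memF 1 0 ⇔ ren ![1] P) : Fml 0)

/-- The category of definable sets: the full subcategory of the category of definable classes on
the classes `{x | P}` that ZF proves to be sets. -/
abbrev DST := ObjectProperty.FullSubcategory (C := DCL) (fun P => IsDefinableSet P)

namespace DST

/-- The definable set `{x | P}`. -/
abbrev of (P : Fml 1) (h : IsDefinableSet P) : DST := ⟨P, h⟩

/-- The formula `P` of the definable set `{x | P}`. -/
abbrev fml (X : DST) : Fml 1 := X.obj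

/-- The inclusion of the definable sets into the syntactic category of ZF. -/
abbrev inclusion : DST ⥤ SynCat ZF :=
  ObjectProperty.ι (C := DCL) (fun P => IsDefinableSet P) ⋙ inducedFunctor _

/-- The arrow `f` is the equivalence class of the formula `F`. -/
def IsClassOf {X Y : DST} (f : X ⟶ Y) (F : Fml (1 + 1)) : Prop :=
  ∃ h : SynCat.IsFunctional (inclusion.obj X) (inclusion.obj Y) F,
    inclusion.map f = Quotient.mk (SynCat.funRelSetoid _ _) ⟨F, h⟩

end DST

/-- `∃ x y, z = ⟨x, y⟩ ∧ P(x) ∧ Q(y)`, in the context `z`. -/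
def prodFml (P Q : Fml 1) : Fml 1 :=
  ∃' ∃' (ren ![0, 1, 2] pairF ⊓ ren ![1] P ⊓ ren ![2] Q)

/-- `∃ x y, z = ⟨x, y⟩ ∧ P(x) ∧ Q(y) ∧ x' = x`, in the context `z, x'`. -/
def fstFml (P Q : Fml 1) : Fml (1 + 1) :=
  ∃' ∃' (ren ![0, 2, 3] pairF ⊓ ren ![2] P ⊓ ren ![3] Q ⊓ eqF 1 2)

/-- `∃ x y, z = ⟨x, y⟩ ∧ P(x) ∧ Q(y) ∧ y' = y`, in the context `z, y'`. -/
def sndFml (P Q : Fml 1) : Fml (1 + 1) :=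
  ∃' ∃' (ren ![0, 2, 3] pairF ⊓ ren ![2] P ⊓ ren ![3] Q ⊓ eqF 1 3)

/-- `x = 0 ∨ x = 1`. -/
def omegaFml : Fml 1 := emptyF ⊔ oneF

/-- `x = 0 ∧ x' = 1`, in the context `x, x'`. -/
def truthFml : Fml (1 + 1) := ren ![0] emptyF ⊓ ren ![1] oneF

/-- `Fun(f) ∧ (∀ s, s ∈ dom(f) ↔ P(s)) ∧ (∀ s', s' ∈ ran(f) → Q(s'))`, in the context `f`. -/
def expFml (P Q : Fml 1) : Fml 1 :=
  funF ⊓ (∀' (ren ![1, 0] memDomF ⇔ ren ![1] P)) ⊓ (∀' (ren ![1, 0] memRanF ⟹ ren ![1] Q))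

/-- `∃ f x, z = ⟨f, x⟩ ∧ f ∈ {f | expFml P Q} ∧ ⟨x, y⟩ ∈ f`, in the context `z, y`. -/
def evalFml (P Q : Fml 1) : Fml (1 + 1) :=
  ∃' ∃' (ren ![0, 2, 3] pairF ⊓ ren ![2] (expFml P Q) ⊓ ren ![3, 1, 2] pairMemF)

/-! ### Toposes -/

section Topos

universe v u

variable {C : Type u} [Category.{v} C]

/-- An elementary topos: a cartesian closed category with all finite limits and a subobject
classifier. -/
structure IsElementaryTopos (C : Type u) [Category.{v} C] : Prop where
  hasFiniteLimits : HasFiniteLimits C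
  cartesianClosed : ∃ _ : CartesianMonoidalCategory C, Nonempty (MonoidalClosed C)
  hasSubobjectClassifier : HasSubobjectClassifier C

/-- The arrows `p` and `q` exhibit `W` as a product of `A` and `B`. -/
def IsProduct {W A B : C} (p : W ⟶ A) (q : W ⟶ B) : Prop :=
  Nonempty (IsLimit (BinaryFan.mk p q))

/-- The arrow `t` has a terminal domain, and every monomorphism is the pullback of `t` along a
unique arrow. -/
def IsSubobjectClassifier {I Ω : C} (t : I ⟶ Ω) : Prop :=
  Nonempty (IsTerminal I) ∧
    ∀ ⦃U X : C⦄ (m : U ⟶ X), Mono m → ∃! χ : X ⟶ Ω, ∃ u : U ⟶ I, IsPullback m u χ t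

/-- The object `E` is an exponential of `Y` by `X`, with evaluation `ev : W = E × X ⟶ Y`: every
`g : Z × X ⟶ Y` is `ev ∘ (g' × id)` for a unique `g' : Z ⟶ E`. -/
def IsExponential {X Y E W : C} (p : W ⟶ E) (q : W ⟶ X) (ev : W ⟶ Y) : Prop :=
  IsProduct p q ∧
    ∀ ⦃Z V : C⦄ (r : V ⟶ Z) (s : V ⟶ X), IsProduct r s → ∀ g : V ⟶ Y,
      ∃! g' : Z ⟶ E, ∃ k : V ⟶ W, k ≫ p = r ≫ g' ∧ k ≫ q = s ∧ k ≫ ev = g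

end Topos

end DefinableSets

open DefinableSets

namespace DefinableSets

/-! ### Satisfaction -/

/-! By Gödel's completeness theorem (`derives_iff`) provability is truth in all models. An arrow of
the syntactic category is then a family of functions between the point sets of its objects, one
function per model, whose graphs are all defined by a single formula (`SynCat.eval`,
`SynCat.exists_formula`). Two arrows are equal as soon as these functions agree (`SynCat.hom_ext`),
and conversely a formula that defines a function in every model gives an arrow. A universal property
thus splits into an ordinary statement about sets of points and the remark that the mediating map is
definable. The latter is usually automatic, because a solution that is unique in every model is
defined by the condition it solves (`SynCat.exists_hom_of_existsUnique`, `SynCat.exists_lift`).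

In a model of ZF the rest is elementary set theory. A class is a set as soon as it is contained in a
set, by separation. Pullbacks are bounded by the set of Kuratowski pairs, and function sets by the
power set of that set. Finite limits are verified in the whole syntactic category, whence both their
existence among definable sets and their preservation by the fully faithful inclusion.

A monomorphism of the syntactic category is injective in every model, because its kernel pair is
again an object. Its characteristic function sends x to 1 exactly when x is in the image, and this
is definable. The result passes to definable sets because the inclusion preserves monomorphisms and
preserves and reflects pullbacks.

For exponentials, an arrow g on a product V of Z and X, with projections r and s, has the transpose
z ↦ {⟨s v, g v⟩ : r v = z}. This is a set by separation, it is uniformly definable from z, and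
extensionality makes it the only choice.

Completeness itself is proved by a Henkin construction. Consistent sets of formulas in finite
contexts serve as forcing conditions, an ideal meeting countably many cofinal sets decides every
formula and supplies counterexamples, and the variables modulo forced equality form the model. -/

theorem ren_memF {n m : ℕ} (σ : Fin n → Fin m) (i j : Fin n) :
    ren σ (memF i j) = memF (σ i) (σ j) := by
  simp only [ren, memF, Relations.boundedFormula₂, Relations.boundedFormula]
  congr 1
  funext k
  fin_cases k <;> rfl

theorem snoc_comp_liftVar {M : Type*} {n m : ℕ} (σ : Fin n → Fin m) (v : Fin m → M) (a : M) :
    (Fin.snoc v a : Fin (m + 1) → M) ∘ liftVar σ = Fin.snoc (v ∘ σ) a := by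
  funext i
  refine Fin.lastCases ?_ (fun i => ?_) i <;> simp [liftVar]

section Sat

variable {M : Type*} [setLang.Structure M] {n m : ℕ}

/-- The membership relation of a structure for the language of set theory. -/
def Mem (a b : M) : Prop := Structure.RelMap (L := setLang) SetRel.mem ![a, b]

/-- The structure `M` satisfies `φ` at the values `v` of the variables of the context. -/
def Sat (φ : Fml n) (v : Fin n → M) : Prop := BoundedFormula.Realize φ (default : Empty → M) v

@[simp] theorem sat_bot (v : Fin n → M) : ¬Sat (⊥ : Fml n) v := id

@[simp] theorem sat_top (v : Fin n → M) : Sat (⊤ : Fml n) v := by simp [Sat]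

@[simp] theorem sat_imp (φ ψ : Fml n) (v : Fin n → M) : Sat (φ ⟹ ψ) v ↔ (Sat φ v → Sat ψ v) :=
  Iff.rfl

@[simp] theorem sat_not (φ : Fml n) (v : Fin n → M) : Sat (∼φ) v ↔ ¬Sat φ v := Iff.rfl

@[simp] theorem sat_and (φ ψ : Fml n) (v : Fin n → M) : Sat (φ ⊓ ψ) v ↔ Sat φ v ∧ Sat ψ v := by
  simp [Sat]

@[simp] theorem sat_or (φ ψ : Fml n) (v : Fin n → M) : Sat (φ ⊔ ψ) v ↔ Sat φ v ∨ Sat ψ v := by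
  simp [Sat]

@[simp] theorem sat_iff (φ ψ : Fml n) (v : Fin n → M) : Sat (φ ⇔ ψ) v ↔ (Sat φ v ↔ Sat ψ v) := by
  simp [Sat]

@[simp] theorem sat_all (φ : Fml (n + 1)) (v : Fin n → M) :
    Sat (∀' φ) v ↔ ∀ a, Sat φ (Fin.snoc v a : Fin (n + 1) → M) := Iff.rfl

@[simp] theorem sat_ex (φ : Fml (n + 1)) (v : Fin n → M) :
    Sat (∃' φ) v ↔ ∃ a, Sat φ (Fin.snoc v a : Fin (n + 1) → M) := by
  simp [Sat]

@[simp] theorem sat_eqF (i j : Fin n) (v : Fin n → M) : Sat (eqF i j) v ↔ v i = v j := by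
  simp [Sat, eqF]

@[simp] theorem sat_memF (i j : Fin n) (v : Fin n → M) : Sat (memF i j) v ↔ Mem (v i) (v j) := by
  exact BoundedFormula.realize_rel₂

theorem exists_term_eq (t : setLang.Term (Empty ⊕ Fin n)) : ∃ i : Fin n, t = &i :=
  match t with
  | .var (.inl a) => a.elim
  | .var (.inr i) => ⟨i, rfl⟩
  | .func f _ => (f : Empty).elim

/-- Induction on formulas of set theory, whose only terms are variables. -/
theorem Fml.induction {motive : ∀ n, Fml n → Prop} (falsum : ∀ n, motive n ⊥)
    (equal : ∀ n (i j : Fin n), motive n (eqF i j)) (mem : ∀ n (i j : Fin n), motive n (memF i j))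
    (imp : ∀ n (φ ψ : Fml n), motive n φ → motive n ψ → motive n (φ ⟹ ψ))
    (all : ∀ n (φ : Fml (n + 1)), motive (n + 1) φ → motive n (∀' φ)) {n : ℕ} (φ : Fml n) :
    motive n φ := by
  induction φ with
  | falsum => exact falsum _
  | equal t s =>
    obtain ⟨i, rfl⟩ := exists_term_eq t
    obtain ⟨j, rfl⟩ := exists_term_eq s
    exact equal _ i j
  | @rel n l R ts =>
    cases R
    obtain ⟨i, hi⟩ := exists_term_eq (ts 0)
    obtain ⟨j, hj⟩ := exists_term_eq (ts 1)
    have : ts = ![&i, &j] := by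
      funext k
      fin_cases k
      exacts [hi, hj]
    rw [this]
    exact mem _ i j
  | imp φ ψ h h' => exact imp _ _ _ h h'
  | all φ h => exact all _ _ h

@[simp] theorem sat_ren (σ : Fin n → Fin m) (φ : Fml n) (v : Fin m → M) :
    Sat (ren σ φ) v ↔ Sat φ (v ∘ σ) := by
  induction φ using Fml.induction generalizing m with
  | falsum => exact Iff.rfl
  | equal n i j => rw [ren_eqF]; simp
  | mem n i j =>
    rw [ren_memF]
    simp
  | imp n φ ψ h h' => exact imp_congr (h σ v) (h' σ v)
  | all n φ h =>
    refine forall_congr' fun a => (h (liftVar σ) _).trans ?_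
    rw [snoc_comp_liftVar]
    rfl

theorem sat_weaken (φ : Fml n) (v : Fin n → M) (a : M) :
    Sat (weaken φ) (Fin.snoc v a : Fin (n + 1) → M) ↔ Sat φ v := by
  have : (Fin.snoc v a : Fin (n + 1) → M) ∘ Fin.castSucc = v := by funext i; simp
  simp [weaken, this]

theorem sat_inst (φ : Fml (n + 1)) (i : Fin n) (v : Fin n → M) :
    Sat (inst φ i) v ↔ Sat φ (Fin.snoc v (v i) : Fin (n + 1) → M) := by
  have : v ∘ (Fin.snoc (α := fun _ => Fin n) id i) = Fin.snoc v (v i) := by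
    funext j
    refine Fin.lastCases ?_ (fun j => ?_) j <;> simp
  rw [inst, sat_ren, this]

@[simp] theorem sat_exN (m : ℕ) (φ : Fml (n + m)) (v : Fin n → M) :
    Sat (exN m φ) v ↔ ∃ y : Fin m → M, Sat φ (Fin.append v y) := by
  induction m with
  | zero =>
    have (y : Fin 0 → M) : Fin.append v y = v := funext fun i => Fin.append_left v y i
    simp [exN, this]
  | succ m ih =>
    simp only [exN, ih, sat_ex]
    constructor
    · rintro ⟨y, a, h⟩
      exact ⟨Fin.snoc y a, by rwa [Fin.append_snoc]⟩
    · rintro ⟨y, h⟩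
      refine ⟨Fin.init y, y (Fin.last m), ?_⟩
      rwa [← Fin.append_snoc, Fin.snoc_init_self]

@[simp] theorem sat_eqs {k : ℕ} (u v : Fin k → Fin n) (x : Fin n → M) :
    Sat (eqs u v) x ↔ x ∘ u = x ∘ v := by
  have : ∀ l : List (Fin k), Sat ((l.map fun i => eqF (u i) (v i)).foldr (· ⊓ ·) ⊤) x ↔
      ∀ i ∈ l, x (u i) = x (v i) := by
    intro l
    induction l with
    | nil => simp
    | cons a l ih => simp [ih]
  rw [eqs, this, funext_iff]
  simp

theorem models_iff_sat {T : setLang.Theory} :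
    M ⊨ T ↔ ∀ σ ∈ T, Sat (M := M) (n := 0) σ Fin.elim0 := by
  have (σ : setLang.Sentence) : M ⊨ σ ↔ Sat (M := M) (n := 0) σ Fin.elim0 := by
    have e : (Fin.elim0 : Fin 0 → M) = default := Subsingleton.elim _ _
    rw [e]
    rfl
  simp [Theory.model_iff, this]

/-! ### Soundness -/

theorem Derives.sound [Nonempty M] {T : setLang.Theory} [hT : M ⊨ T] {Γ : Set (Fml n)} {φ : Fml n}
    (h : Derives T Γ φ) (v : Fin n → M) (hv : ∀ γ ∈ Γ, Sat γ v) : Sat φ v := by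
  induction h with
  | ax σ hσ =>
    rw [sat_ren, show v ∘ Fin.elim0 = Fin.elim0 from funext fun i => i.elim0]
    exact models_iff_sat.1 hT σ hσ
  | hyp h => exact hv _ h
  | impI h ih => exact fun hφ => ih v (Set.forall_mem_insert.2 ⟨hφ, hv⟩)
  | impE h h' ih ih' => exact ih v hv (ih' v hv)
  | byContra h ih => exact by_contra fun hφ => ih v (Set.forall_mem_insert.2 ⟨hφ, hv⟩)
  | allI h ih =>
    refine fun a => ih _ ?_
    rintro _ ⟨γ, hγ, rfl⟩
    exact (sat_weaken γ v a).2 (hv γ hγ)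
  | allE h i ih => exact (sat_inst _ _ _).2 (ih v hv _)
  | eqI i => simp
  | eqE φ h h' ih ih' =>
    have e := (sat_eqF _ _ _).1 (ih v hv)
    rw [sat_inst, ← e]
    exact (sat_inst _ _ _).1 (ih' v hv)
  | nonempty => simp

end Sat

/-! ### Completeness -/

variable {T : setLang.Theory}

/-- A consistent set of formulas in a finite context. -/
structure ConsistentSet (T : setLang.Theory) where
  arity : ℕ
  formulas : Set (Fml arity)
  consistent : ¬Derives T formulas ⊥

namespace ConsistentSet

/-- A stronger condition may use more variables, but the old ones keep their numbers. A natural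
number is therefore a name that means the same in all conditions where it occurs. -/
instance : Preorder (ConsistentSet T) where
  le p q := ∃ h : p.arity ≤ q.arity, ∀ γ ∈ p.formulas, ren (Fin.castLE h) γ ∈ q.formulas
  le_refl p := ⟨le_rfl, fun γ hγ => by
    rw [show Fin.castLE (le_refl p.arity) = id from rfl, ren_id]; exact hγ⟩
  le_trans p q r := by
    rintro ⟨h, h1⟩ ⟨h', h2⟩
    refine ⟨h.trans h', fun γ hγ => ?_⟩
    have := h2 _ (h1 γ hγ)
    rwa [ren_ren] at this

/-- The consistent set `p` with one more formula. -/
def insert (p : ConsistentSet T) (φ : Fml p.arity) (h : ¬Derives T (Insert.insert φ p.formulas) ⊥) :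
    ConsistentSet T :=
  ⟨p.arity, Insert.insert φ p.formulas, h⟩

theorem le_insert (p : ConsistentSet T) (φ : Fml p.arity)
    (h : ¬Derives T (Insert.insert φ p.formulas) ⊥) : p ≤ p.insert φ h := by
  refine ⟨le_refl p.arity, fun γ hγ => Or.inr ?_⟩
  have : ren (id : Fin p.arity → Fin p.arity) γ ∈ p.formulas := by rwa [ren_id]
  exact this

/-- Adding an unused variable cannot create a contradiction, because the universe is provably
nonempty: `exE` applied to `nonempty` removes the variable again. -/
theorem exists_arity_ge (p : ConsistentSet T) (n : ℕ) : ∃ q, p ≤ q ∧ n ≤ q.arity := by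
  induction n with
  | zero => exact ⟨p, le_rfl, Nat.zero_le _⟩
  | succ n ih =>
    obtain ⟨q, hpq, hq⟩ := ih
    refine ⟨⟨q.arity + 1, weaken '' q.formulas, fun h => q.consistent ?_⟩, hpq.trans ?_,
      Nat.succ_le_succ hq⟩
    · exact .exE .nonempty (h.mono (Set.subset_insert _ _))
    · exact ⟨Nat.le_succ _, fun γ hγ => ⟨γ, hγ, rfl⟩⟩

/-- If both a formula and its negation were inconsistent with a condition, the condition would
refute itself. -/
theorem exists_decides (p : ConsistentSet T) {n : ℕ} (φ : Fml n) :
    ∃ q, p ≤ q ∧ ∃ h : n ≤ q.arity,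
      ren (Fin.castLE h) φ ∈ q.formulas ∨ ∼(ren (Fin.castLE h) φ) ∈ q.formulas := by
  obtain ⟨q, hpq, hq⟩ := p.exists_arity_ge n
  by_cases h : Derives T (Insert.insert (ren (Fin.castLE hq) φ) q.formulas) ⊥
  · have h' : ¬Derives T (Insert.insert (∼(ren (Fin.castLE hq) φ)) q.formulas) ⊥ :=
      fun h' => q.consistent (.cut (.byContra h') h)
    exact ⟨q.insert _ h', hpq.trans (q.le_insert _ h'), hq, Or.inr (Or.inl rfl)⟩
  · exact ⟨q.insert _ h, hpq.trans (q.le_insert _ h), hq, Or.inl (Or.inl rfl)⟩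

/-- Henkin witnesses: if the negated universal formula has been accepted, a fresh variable may be
declared a counterexample. Were this inconsistent, the instance at the fresh variable would be
derivable, and generalising it would give the universal formula. -/
theorem exists_counterexample (p : ConsistentSet T) {n : ℕ} (φ : Fml (n + 1)) :
    ∃ q, p ≤ q ∧ ∃ h : n ≤ q.arity, ren (Fin.castLE h) (∀' φ) ∈ q.formulas ∨
      ∃ i, ∼(ren (Fin.snoc (α := fun _ => Fin q.arity) (Fin.castLE h) i) φ) ∈ q.formulas := by
  obtain ⟨q, hpq, h, hq⟩ := p.exists_decides (∀' φ)
  rcases hq with hq | hq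
  · exact ⟨q, hpq, h, Or.inl hq⟩
  let ψ : Fml (q.arity + 1) := ren (liftVar (Fin.castLE h)) φ
  have hc : ¬Derives T (Insert.insert (∼ψ) (weaken '' q.formulas)) ⊥ := fun h' =>
    q.consistent (.impE (.hyp hq) (.allI (.byContra h')))
  refine ⟨⟨q.arity + 1, _, hc⟩, hpq.trans ⟨Nat.le_succ _, fun γ hγ => Or.inr ⟨γ, hγ, rfl⟩⟩,
    h.trans (Nat.le_succ _), Or.inr ⟨Fin.last _, Or.inl ?_⟩⟩
  rfl

end ConsistentSet

instance : Countable setLang.Symbols := by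
  have : Countable (Σ l, setLang.Functions l) := ⟨fun x => (x.2 : Empty).elim, fun x => (x.2 : Empty).elim⟩
  have : Countable (Σ l, setLang.Relations l) := by
    refine ⟨fun _ => 0, ?_⟩
    rintro ⟨_, ⟨⟩⟩ ⟨_, ⟨⟩⟩ _
    rfl
  exact inferInstanceAs (Countable ((Σ l, setLang.Functions l) ⊕ (Σ l, setLang.Relations l)))

/-- An ideal of consistent sets of formulas is generic if it decides every formula, and contains a
counterexample to every refuted universal formula. -/
structure IsGeneric (G : Order.Ideal (ConsistentSet T)) : Prop where
  decides : ∀ {n : ℕ} (φ : Fml n), ∃ q ∈ G, ∃ h : n ≤ q.arity,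
      ren (Fin.castLE h) φ ∈ q.formulas ∨ ∼(ren (Fin.castLE h) φ) ∈ q.formulas
  counterexample : ∀ {n : ℕ} (φ : Fml (n + 1)), ∃ q ∈ G, ∃ h : n ≤ q.arity,
      ren (Fin.castLE h) (∀' φ) ∈ q.formulas ∨
        ∃ i, ∼(ren (Fin.snoc (α := fun _ => Fin q.arity) (Fin.castLE h) i) φ) ∈ q.formulas

/-- The Rasiowa–Sikorski lemma: the language is countable, so there are only countably many cofinal
sets to meet, one for each requirement of genericity. -/
theorem exists_isGeneric (p : ConsistentSet T) :
    ∃ G : Order.Ideal (ConsistentSet T), p ∈ G ∧ IsGeneric G := by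
  have : Encodable ((Σ n, Fml n) ⊕ (Σ n, Fml n)) := Encodable.ofCountable _
  let 𝒟 : (Σ n, Fml n) ⊕ (Σ n, Fml n) → Order.Cofinal (ConsistentSet T)
    | .inl φ => ⟨_, fun p => by
        obtain ⟨q, h, h'⟩ := p.exists_decides φ.2
        exact ⟨q, h', h⟩⟩
    | .inr ⟨n + 1, φ⟩ => ⟨_, fun p => by
        obtain ⟨q, h, h'⟩ := p.exists_counterexample φ
        exact ⟨q, h', h⟩⟩
    -- A formula in the empty context is not the body of a quantifier, so it imposes no requirement.
    | .inr ⟨0, _⟩ => ⟨Set.univ, fun p => ⟨p, trivial, le_rfl⟩⟩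
  refine ⟨Order.idealOfCofinals p 𝒟, Order.mem_idealOfCofinals p 𝒟, fun {n} φ => ?_, fun {n} φ => ?_⟩
  · obtain ⟨q, h, h'⟩ := Order.cofinal_meets_idealOfCofinals p 𝒟 (.inl ⟨n, φ⟩)
    exact ⟨q, h', h⟩
  · obtain ⟨q, h, h'⟩ := Order.cofinal_meets_idealOfCofinals p 𝒟 (.inr ⟨n + 1, φ⟩)
    exact ⟨q, h', h⟩

/-! ### The term model of a generic ideal -/

namespace IsGeneric

variable {G : Order.Ideal (ConsistentSet T)} {n : ℕ}

/-- The formula `φ` is forced by `G` at the variables numbered `v i`. -/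
def Holds (G : Order.Ideal (ConsistentSet T)) (φ : Fml n) (v : Fin n → ℕ) : Prop :=
  ∃ p ∈ G, ∃ u : Fin n → Fin p.arity, (∀ i, (u i : ℕ) = v i) ∧ Derives T p.formulas (ren u φ)

theorem derives_of_le {p q : ConsistentSet T} (h : p ≤ q) {φ : Fml p.arity}
    (hφ : Derives T p.formulas φ) : Derives T q.formulas (ren (Fin.castLE h.1) φ) :=
  hφ.rename _ h.2

theorem exists_arity_ge (hG : IsGeneric G) (n : ℕ) : ∃ q ∈ G, n ≤ q.arity :=
  let ⟨q, h, h', _⟩ := hG.decides (⊥ : Fml n)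
  ⟨q, h, h'⟩

/-- By directedness both premises hold at one condition, and the two substitutions become equal
there since they have the same variable numbers as values. Single-premise rules are obtained by
repeating the premise. -/
theorem holds_of_derives {φ ψ χ : Fml n} {v : Fin n → ℕ} (hφ : Holds G φ v)
    (hψ : Holds G ψ v) (h : Derives T {φ, ψ} χ) : Holds G χ v := by
  obtain ⟨p, hp, u, hu, hφ⟩ := hφ
  obtain ⟨q, hq, u', hu', hψ⟩ := hψ
  obtain ⟨r, hr, hpr, hqr⟩ := G.directed p hp q hq
  refine ⟨r, hr, Fin.castLE hpr.1 ∘ u, hu, h.subst _ ?_⟩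
  rintro _ (rfl | rfl)
  · rw [← ren_ren]
    exact derives_of_le hpr hφ
  · have : Fin.castLE hpr.1 ∘ u = Fin.castLE hqr.1 ∘ u' := by
      funext i
      exact Fin.ext ((hu i).trans (hu' i).symm)
    rw [this, ← ren_ren]
    exact derives_of_le hqr hψ

theorem holds_of_derives_empty (hG : IsGeneric G) {φ : Fml n} (h : Derives T ∅ φ) (v : Fin n → ℕ) :
    Holds G φ v := by
  -- The variables in use are numbered up to the supremum of `v`, so the context must be longer by
  -- one.
  obtain ⟨p, hp, h'⟩ := hG.exists_arity_ge ((Finset.univ.sup v) + 1)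
  refine ⟨p, hp, fun i => ⟨v i, lt_of_lt_of_le (Nat.lt_succ_of_le ?_) h'⟩, fun i => rfl,
    h.subst _ (by simp)⟩
  exact Finset.le_sup (Finset.mem_univ i)

theorem not_holds_bot {v : Fin n → ℕ} : ¬Holds G ⊥ v := by
  rintro ⟨p, -, u, -, h⟩
  exact p.consistent h

theorem holds_ren (hG : IsGeneric G) {m : ℕ} {φ : Fml n} {σ : Fin n → Fin m} {v : Fin m → ℕ} :
    Holds G (ren σ φ) v ↔ Holds G φ (v ∘ σ) := by
  constructor
  · rintro ⟨p, hp, u, hu, h⟩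
    rw [ren_ren] at h
    exact ⟨p, hp, u ∘ σ, fun i => hu (σ i), h⟩
  · rintro ⟨p, hp, u, hu, h⟩
    -- The condition at hand only knows the variables in the image of `σ`; the other values of `v`
    -- may lie outside its context.
    obtain ⟨q, hq, hv⟩ := hG.exists_arity_ge ((Finset.univ.sup v) + 1)
    obtain ⟨r, hr, hpr, hqr⟩ := G.directed p hp q hq
    refine ⟨r, hr, fun i => ⟨v i, lt_of_lt_of_le (Nat.lt_succ_of_le ?_) (hv.trans hqr.1)⟩,
      fun i => rfl, ?_⟩
    · exact Finset.le_sup (Finset.mem_univ i)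
    · rw [ren_ren]
      have := derives_of_le hpr h
      rw [ren_ren] at this
      convert this using 2
      funext i
      exact Fin.ext (hu i).symm

theorem holds_not (hG : IsGeneric G) {φ : Fml n} {v : Fin n → ℕ} :
    Holds G (∼φ) v ↔ ¬Holds G φ v := by
  constructor
  · intro h h'
    exact not_holds_bot (holds_of_derives h h' (.impE (.hyp (Or.inl rfl)) (.hyp (Or.inr rfl))))
  · intro h
    obtain ⟨p, hp, hv⟩ := hG.exists_arity_ge ((Finset.univ.sup v) + 1)
    have hv' (i) : v i < p.arity :=
      lt_of_lt_of_le (Nat.lt_succ_of_le (Finset.le_sup (Finset.mem_univ i))) hv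
    obtain ⟨q, hq, hn, hd⟩ := hG.decides (ren (fun i => ⟨v i, hv' i⟩ : Fin n → Fin p.arity) φ)
    rcases hd with hd | hd
    · refine (h ⟨q, hq, _, fun i => ?_, by rw [ren_ren] at hd; exact .hyp hd⟩).elim
      rfl
    · refine ⟨q, hq, _, fun i => ?_, by rw [ren_ren, ← ren_not] at hd; exact .hyp hd⟩
      rfl

theorem holds_imp (hG : IsGeneric G) {φ ψ : Fml n} {v : Fin n → ℕ} :
    Holds G (φ ⟹ ψ) v ↔ (Holds G φ v → Holds G ψ v) := by
  constructor
  · intro h h'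
    exact holds_of_derives h h' (.impE (.hyp (Or.inl rfl)) (.hyp (Or.inr rfl)))
  · intro h
    by_cases h' : Holds G φ v
    · exact holds_of_derives (h h') (h h') (.impI (.hyp (Or.inr (Or.inl rfl))))
    · have := hG.holds_not.2 h'
      exact holds_of_derives this this (.impI (.exfalso (.impE (φ := φ)
        (.hyp (Or.inr (Or.inl rfl))) (.hyp (Or.inl rfl)))))

theorem holds_all (hG : IsGeneric G) {φ : Fml (n + 1)} {v : Fin n → ℕ} :
    Holds G (∀' φ) v ↔ ∀ a, Holds G φ (Fin.snoc v a : Fin (n + 1) → ℕ) := by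
  constructor
  · intro h a
    have h1 : Holds G (weaken (∀' φ)) (Fin.snoc v a : Fin (n + 1) → ℕ) := by
      rw [weaken, hG.holds_ren]
      convert h using 1
      funext i
      simp
    have h2 : Derives T {weaken (∀' φ)} φ := by
      have : Derives T {weaken (∀' φ)} (weaken (∀' φ)) := .hyp rfl
      have := Derives.allE this (Fin.last n)
      rw [inst, ren_ren] at this
      convert this
      rw [show _ ∘ _ = (id : Fin (n + 1) → Fin (n + 1)) from ?_, ren_id]
      funext i
      refine Fin.lastCases ?_ (fun i => ?_) i <;> simp [liftVar]
    exact holds_of_derives h1 h1 (by simpa using h2)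
  · intro h
    obtain ⟨p, hp, hv⟩ := hG.exists_arity_ge ((Finset.univ.sup v) + 1)
    have hv' (i) : v i < p.arity :=
      lt_of_lt_of_le (Nat.lt_succ_of_le (Finset.le_sup (Finset.mem_univ i))) hv
    let u : Fin n → Fin p.arity := fun i => ⟨v i, hv' i⟩
    -- Either the ideal accepts the universal formula, or it names a variable at which the instance
    -- fails, against `h`.
    obtain ⟨q, hq, hn, hd⟩ := hG.counterexample (ren (liftVar u) φ)
    rcases hd with hd | ⟨a, hd⟩
    · refine ⟨q, hq, _, fun i => ?_, Derives.hyp (by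
        rw [show ∀' (ren (liftVar u) φ) = ren u (∀' φ) from rfl, ren_ren] at hd; exact hd)⟩
      rfl
    · refine (hG.holds_not.1 ⟨q, hq, _, fun i => ?_, .hyp (by
        rw [ren_ren, ← ren_not] at hd; exact hd)⟩ (h a)).elim
      refine Fin.lastCases ?_ (fun i => ?_) i
      · simp [liftVar]
      · simp only [liftVar, Function.comp, Fin.snoc_castSucc]
        rfl

theorem holds_eqF (hG : IsGeneric G) {i j : Fin n} {v : Fin n → ℕ} :
    Holds G (eqF i j) v ↔ Holds G (eqF 0 1) ![v i, v j] := by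
  rw [show eqF i j = ren ![i, j] (eqF 0 1) from rfl, hG.holds_ren]
  convert Iff.rfl using 2
  funext k
  fin_cases k <;> rfl

theorem holds_memF (hG : IsGeneric G) {i j : Fin n} {v : Fin n → ℕ} :
    Holds G (memF i j) v ↔ Holds G (memF 0 1) ![v i, v j] := by
  rw [show memF i j = ren ![i, j] (memF 0 1) from (ren_memF ![i, j] 0 1).symm, hG.holds_ren]
  convert Iff.rfl using 2
  funext k
  fin_cases k <;> rfl

/-- Variables are identified if `G` forces them to be equal. -/
def setoid (hG : IsGeneric G) : Setoid ℕ where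
  r a b := Holds G (eqF 0 1) ![a, b]
  iseqv :=
    { refl := fun a => (hG.holds_eqF (i := 0) (j := 0) (v := ![a])).1
        (hG.holds_of_derives_empty (.eqI 0) ![a])
      symm := fun {a b} h => (hG.holds_eqF (i := 1) (j := 0) (v := ![a, b])).1
        (holds_of_derives h h (.eqSymm (.hyp (Or.inl rfl))))
      trans := fun {a b c} h h' => (hG.holds_eqF (i := 0) (j := 2) (v := ![a, b, c])).1
        (holds_of_derives ((hG.holds_eqF (i := 0) (j := 1) (v := ![a, b, c])).2 h)
          ((hG.holds_eqF (i := 1) (j := 2) (v := ![a, b, c])).2 h')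
          (.eqTrans (.hyp (Or.inl rfl)) (.hyp (Or.inr rfl)))) }

/-- The universe of the term model. -/
def Carrier (hG : IsGeneric G) : Type := Quotient hG.setoid

/-- The element of the term model denoted by a variable. -/
def var (hG : IsGeneric G) (a : ℕ) : hG.Carrier := Quotient.mk hG.setoid a

/-- Membership asks for some pair of representatives, so nothing has to be lifted to the quotient
here. Independence of the representatives is the content of `mem_var_iff`. -/
instance (hG : IsGeneric G) : setLang.Structure hG.Carrier where
  funMap f := (f : Empty).elim
  RelMap {_} R := match R with
    | .mem => fun x => ∃ a b, hG.var a = x 0 ∧ hG.var b = x 1 ∧ Holds G (memF 0 1) ![a, b]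

instance (hG : IsGeneric G) : Nonempty hG.Carrier := ⟨hG.var 0⟩

theorem var_eq_iff (hG : IsGeneric G) {a b : ℕ} :
    hG.var a = hG.var b ↔ Holds G (eqF 0 1) ![a, b] :=
  Quotient.eq (r := hG.setoid)

/-- Leibniz's rule `eqE` replaces the left representative and then the right one, each time in a
context of three variables. -/
theorem mem_var_iff (hG : IsGeneric G) {a b : ℕ} :
    Mem (hG.var a) (hG.var b) ↔ Holds G (memF 0 1) ![a, b] := by
  constructor
  · rintro ⟨a', b', ha, hb, h⟩
    have ha : hG.var a' = hG.var a := ha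
    have hb : hG.var b' = hG.var b := hb
    rw [var_eq_iff] at ha hb
    have h1 : Holds G (memF 1 2) ![a', a, b'] :=
      holds_of_derives ((hG.holds_eqF (i := 0) (j := 1) (v := ![a', a, b'])).2 ha) ((hG.holds_memF (i := 0) (j := 2) (v := ![a', a, b'])).2 h) (by
        rw [show memF 1 2 = inst (n := 3) (memF 3 2) 1 by rw [inst, ren_memF]; rfl]
        refine .eqE _ (i := 0) (.hyp (Or.inl rfl)) (.hyp (Or.inr ?_))
        rw [inst, ren_memF]
        rfl)
    have h2 : Holds G (memF 0 2) ![a, b', b] :=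
      holds_of_derives ((hG.holds_eqF (i := 1) (j := 2) (v := ![a, b', b])).2 hb)
        ((hG.holds_memF (i := 0) (j := 1) (v := ![a, b', b])).2
          ((hG.holds_memF (i := 1) (j := 2) (v := ![a', a, b'])).1 h1)) (by
        rw [show memF 0 2 = inst (n := 3) (memF 0 3) 2 by rw [inst, ren_memF]; rfl]
        refine .eqE _ (i := 1) (.hyp (Or.inl rfl)) (.hyp (Or.inr ?_))
        rw [inst, ren_memF]
        rfl)
    exact (hG.holds_memF (v := ![a, b', b])).1 h2
  · intro h
    exact ⟨a, b, rfl, rfl, h⟩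

/-- The truth lemma. `Holds` commutes with implication and universal quantification, and since every
element is named by a variable, quantifying over the model is quantifying over ℕ. -/
theorem sat_iff_holds (hG : IsGeneric G) (φ : Fml n) (v : Fin n → ℕ) :
    Sat φ (hG.var ∘ v) ↔ Holds G φ v := by
  induction φ using Fml.induction with
  | falsum => exact iff_of_false (sat_bot _) not_holds_bot
  | equal n i j =>
    rw [sat_eqF, Function.comp_apply, Function.comp_apply, var_eq_iff]
    exact hG.holds_eqF.symm
  | mem n i j =>
    rw [sat_memF, Function.comp_apply, Function.comp_apply, mem_var_iff]
    exact hG.holds_memF.symm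
  | imp n φ ψ h h' => rw [sat_imp, h, h', hG.holds_imp]
  | all n φ h =>
    rw [sat_all, hG.holds_all]
    have (a : ℕ) : (Fin.snoc (hG.var ∘ v) (hG.var a) : Fin (n + 1) → hG.Carrier) =
        hG.var ∘ (Fin.snoc v a : Fin (n + 1) → ℕ) := by
      funext i
      refine Fin.lastCases ?_ (fun i => ?_) i <;> simp
    constructor
    · intro H a
      rw [← h, ← this]
      exact H _
    · intro H a
      induction a using Quotient.inductionOn with | h a => ?_
      have := this a
      rw [var] at this
      rw [this, h]
      exact H a

theorem models (hG : IsGeneric G) : hG.Carrier ⊨ T := by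
  refine models_iff_sat.2 fun σ hσ => ?_
  rw [show (Fin.elim0 : Fin 0 → hG.Carrier) = hG.var ∘ Fin.elim0 from funext fun i => i.elim0,
    hG.sat_iff_holds]
  have := Derives.ax (T := T) (n := 0) (Γ := ∅) σ hσ
  rw [show (Fin.elim0 : Fin 0 → Fin 0) = id from funext fun i => i.elim0, ren_id] at this
  exact hG.holds_of_derives_empty this _

end IsGeneric

/-- A model of the theory `T`. -/
abbrev Mod (T : setLang.Theory) := Theory.ModelType.{0, 0, 0} T

/-- Gödel's completeness theorem. -/
theorem derives_iff {n : ℕ} {Γ : Set (Fml n)} {φ : Fml n} :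
    Derives T Γ φ ↔ ∀ (M : Mod T) (v : Fin n → M), (∀ γ ∈ Γ, Sat γ v) → Sat φ v := by
  refine ⟨fun h M v hv => h.sound v hv, fun h => by_contra fun hc => ?_⟩
  -- If φ is not derivable, Γ together with its negation is consistent. In a term model containing
  -- this condition each variable denotes its own class, which satisfies Γ and refutes φ.
  let p : ConsistentSet T := ⟨n, insert (∼φ) Γ, fun h => hc (.byContra h)⟩
  obtain ⟨G, hp, hG⟩ := exists_isGeneric p
  have := hG.models
  have hs : ∀ γ ∈ p.formulas, Sat γ (hG.var ∘ (fun i : Fin n => (i : ℕ))) := fun γ hγ => by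
    rw [hG.sat_iff_holds]
    exact ⟨p, hp, id, fun _ => rfl, by rw [ren_id]; exact .hyp hγ⟩
  exact hs (∼φ) (Or.inl rfl) (h ⟨hG.Carrier⟩ _ fun γ hγ => hs γ (Or.inr hγ))

variable {T : setLang.Theory}

/-! ### Interpretation of the syntactic category in the models -/

theorem forall_append {M : Type*} {n m : ℕ} {p : (Fin (n + m) → M) → Prop} :
    (∀ v, p v) ↔ ∀ x y, p (Fin.append x y) := by
  refine ⟨fun h x y => h _, fun h v => ?_⟩
  rw [← Fin.append_castAdd_natAdd (f := v)]
  exact h _ _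

theorem comp_fin_append {A B : Type*} {n m : ℕ} (f : A → B) (x : Fin n → A) (y : Fin m → A) :
    f ∘ Fin.append x y = Fin.append (f ∘ x) (f ∘ y) := by
  funext i
  refine Fin.addCases (fun i => ?_) (fun i => ?_) i <;> simp

theorem fin_append_comp_castAdd {A : Type*} {n m : ℕ} (x : Fin n → A) (y : Fin m → A) :
    Fin.append x y ∘ Fin.castAdd m = x := by
  funext i; simp

theorem fin_append_comp_natAdd {A : Type*} {n m : ℕ} (x : Fin n → A) (y : Fin m → A) :
    Fin.append x y ∘ Fin.natAdd n = y := by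
  funext i; simp

namespace SynCat

/-- The tuples of elements of the model `M` that satisfy the formula `X`. -/
abbrev Pts (X : SynCat T) (M : Mod T) : Type := {v : Fin X.arity → M // Sat X.formula v}

/-- Completeness applied to the three clauses at once: provably functional means defining the graph
of a total function between the point sets of every model. -/
theorem isFunctional_iff {X Y : SynCat T} {F : Fml (X.arity + Y.arity)} :
    IsFunctional X Y F ↔ ∀ M : Mod T,
      (∀ (x : Fin X.arity → M) (y : Fin Y.arity → M), Sat F (Fin.append x y) →
        Sat X.formula x ∧ Sat Y.formula y) ∧
      (∀ (x : Fin X.arity → M) (y y' : Fin Y.arity → M), Sat F (Fin.append x y) →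
        Sat F (Fin.append x y') → y = y') ∧
      ∀ x : Fin X.arity → M, Sat X.formula x → ∃ y : Fin Y.arity → M, Sat F (Fin.append x y) := by
  have key : IsFunctional X Y F ↔ _ ∧ _ ∧ _ := ⟨fun h => ⟨h.1, h.2, h.3⟩, fun h => ⟨h.1, h.2.1, h.2.2⟩⟩
  rw [key]
  simp only [derives_iff, Set.mem_singleton_iff, forall_eq, forall_append, sat_and, sat_ren, sat_eqs,
    sat_exN, comp_fin_append, ← Function.comp_assoc, fin_append_comp_castAdd, fin_append_comp_natAdd, and_imp,
    forall_and]

/-- The graph of the arrow `f` in the model `M`. -/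
def Graph {X Y : SynCat T} (f : X ⟶ Y) (M : Mod T) (x : Fin X.arity → M) (y : Fin Y.arity → M) :
    Prop :=
  Quotient.lift (s := funRelSetoid X Y) (fun F => Sat F.1 (Fin.append x y)) (fun F G h => by
    have : Derives T ∅ (F.1 ⇔ G.1) := h
    simpa using derives_iff.1 this M (Fin.append x y) (by simp)) f

theorem graph_exists_unique {X Y : SynCat T} (f : X ⟶ Y) (M : Mod T) (x : X.Pts M) :
    ∃! y : Y.Pts M, Graph f M x.1 y.1 := by
  induction f using Quotient.inductionOn with | h F => ?_
  obtain ⟨h1, h2, h3⟩ := isFunctional_iff.1 F.2 M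
  obtain ⟨y, hy⟩ := h3 x.1 x.2
  exact ⟨⟨y, (h1 _ _ hy).2⟩, hy, fun y' hy' => Subtype.ext (h2 _ _ _ hy' hy)⟩

/-- The function denoted by the arrow `f` in the model `M`. -/
noncomputable def eval {X Y : SynCat T} (f : X ⟶ Y) {M : Mod T} (x : X.Pts M) : Y.Pts M :=
  (graph_exists_unique f M x).choose

theorem graph_iff {X Y : SynCat T} (f : X ⟶ Y) {M : Mod T} {x : Fin X.arity → M}
    {y : Fin Y.arity → M} : Graph f M x y ↔ ∃ h : Sat X.formula x, (eval f ⟨x, h⟩).1 = y := by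
  constructor
  · intro h
    have hd : Sat X.formula x ∧ Sat Y.formula y := by
      induction f using Quotient.inductionOn with | h F => ?_
      exact (isFunctional_iff.1 F.2 M).1 x y h
    refine ⟨hd.1, ?_⟩
    exact congrArg Subtype.val ((graph_exists_unique f M ⟨x, hd.1⟩).choose_spec.2 ⟨y, hd.2⟩ h).symm
  · rintro ⟨h, rfl⟩
    exact (graph_exists_unique f M ⟨x, h⟩).choose_spec.1

/-- Every arrow is the class of a formula that defines the graphs of its interpretations. -/
theorem exists_formula {X Y : SynCat T} (f : X ⟶ Y) : ∃ F : Fml (X.arity + Y.arity),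
    ∀ (M : Mod T) x y, Sat F (Fin.append x y : _ → M) ↔ ∃ h, (eval f ⟨x, h⟩).1 = y := by
  induction f using Quotient.inductionOn with | h F => ?_
  exact ⟨F.1, fun M x y => graph_iff (Quotient.mk _ F)⟩

/-- Formulas with the same graph in all models are provably equivalent by completeness, hence
represent one arrow. -/
theorem hom_ext {X Y : SynCat T} {f g : X ⟶ Y} (h : ∀ (M : Mod T) (x : X.Pts M),
    eval f x = eval g x) : f = g := by
  have hg : ∀ (M : Mod T) x y, Graph f M x y ↔ Graph g M x y := by
    intro M x y
    rw [graph_iff, graph_iff]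
    exact exists_congr fun hx => by rw [h]
  induction f using Quotient.inductionOn with | h F => ?_
  induction g using Quotient.inductionOn with | h G => ?_
  refine Quotient.sound (derives_iff.2 fun M v _ => ?_)
  revert v
  rw [forall_append]
  intro x y
  rw [sat_iff]
  exact fun _ => hg M x y

@[simp] theorem eval_id (X : SynCat T) {M : Mod T} (x : X.Pts M) : eval (𝟙 X) x = x := by
  have : Graph (𝟙 X) M x.1 x.1 := by
    change Sat (idFml X) _
    simpa [idFml, fin_append_comp_castAdd, fin_append_comp_natAdd] using x.2
  obtain ⟨h, h'⟩ := (graph_iff _).1 this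
  exact Subtype.ext h'

@[simp] theorem eval_comp {X Y Z : SynCat T} (f : X ⟶ Y) (g : Y ⟶ Z) {M : Mod T} (x : X.Pts M) :
    eval (f ≫ g) x = eval g (eval f x) := by
  have : Graph (f ≫ g) M x.1 (eval g (eval f x)).1 := by
    have hf : Graph f M x.1 (eval f x).1 := (graph_iff _).2 ⟨x.2, rfl⟩
    have hg : Graph g M (eval f x).1 (eval g (eval f x)).1 := (graph_iff _).2 ⟨(eval f x).2, rfl⟩
    generalize (eval g (eval f x)).1 = z at hg
    generalize (eval f x).1 = y at hf hg
    induction f using Quotient.inductionOn with | h F => ?_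
    induction g using Quotient.inductionOn with | h G => ?_
    change Sat (compFml F.1 G.1) _
    simp only [compFml, sat_exN, sat_and, sat_ren, comp_fin_append, ← Function.comp_assoc,
      fin_append_comp_castAdd, fin_append_comp_natAdd]
    exact ⟨y, hf, hg⟩
  obtain ⟨h, h'⟩ := (graph_iff _).1 this
  exact Subtype.ext h'

/-- A formula that defines the graph of a function in every model is provably functional. -/
theorem isFunctional_of_graph {X Y : SynCat T} (f : ∀ M : Mod T, X.Pts M → Y.Pts M)
    {F : Fml (X.arity + Y.arity)}
    (hF : ∀ (M : Mod T) x y, Sat F (Fin.append x y : _ → M) ↔ ∃ h, (f M ⟨x, h⟩).1 = y) :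
    IsFunctional X Y F := by
  refine isFunctional_iff.2 fun M => ⟨fun x y h => ?_, fun x y y' h h' => ?_, fun x h => ?_⟩
  · obtain ⟨hx, rfl⟩ := (hF M x y).1 h
    exact ⟨hx, (f M ⟨x, hx⟩).2⟩
  · obtain ⟨h, rfl⟩ := (hF M x y).1 h
    obtain ⟨h, rfl⟩ := (hF M x y').1 h'
    rfl
  · exact ⟨_, (hF M x _).2 ⟨h, rfl⟩⟩

theorem eval_mk {X Y : SynCat T} (f : ∀ M : Mod T, X.Pts M → Y.Pts M)
    {F : Fml (X.arity + Y.arity)}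
    (hF : ∀ (M : Mod T) x y, Sat F (Fin.append x y : _ → M) ↔ ∃ h, (f M ⟨x, h⟩).1 = y)
    (h : IsFunctional X Y F) {M : Mod T} (x : X.Pts M) :
    eval (Quotient.mk (funRelSetoid X Y) ⟨F, h⟩ : X ⟶ Y) x = f M x := by
  have : Graph (Quotient.mk (funRelSetoid X Y) ⟨F, h⟩ : X ⟶ Y) M x.1 (f M x).1 :=
    (hF M _ _).2 ⟨x.2, rfl⟩
  obtain ⟨h, h'⟩ := (graph_iff _).1 this
  exact Subtype.ext h'

/-- A uniformly definable family of functions is the interpretation of an arrow. -/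
theorem exists_hom {X Y : SynCat T} (f : ∀ M : Mod T, X.Pts M → Y.Pts M)
    (F : Fml (X.arity + Y.arity))
    (hF : ∀ (M : Mod T) (x : X.Pts M) (y : Y.Pts M),
      Sat F (Fin.append x.1 y.1) ↔ f M x = y) :
    ∃ φ : X ⟶ Y, ∀ (M : Mod T) (x : X.Pts M), eval φ x = f M x := by
  -- Nothing is known about `F` off the points of X and Y, so it is cut down to them.
  have hF' : ∀ (M : Mod T) x y, Sat (ren (Fin.castAdd Y.arity) X.formula ⊓
      ren (Fin.natAdd X.arity) Y.formula ⊓ F) (Fin.append x y : _ → M) ↔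
        ∃ h, (f M ⟨x, h⟩).1 = y := by
    intro M x y
    simp only [sat_and, sat_ren, fin_append_comp_castAdd, fin_append_comp_natAdd]
    constructor
    · rintro ⟨⟨hx, hy⟩, h⟩
      exact ⟨hx, congrArg Subtype.val ((hF M ⟨x, hx⟩ ⟨y, hy⟩).1 h)⟩
    · rintro ⟨hx, rfl⟩
      exact ⟨⟨hx, (f M ⟨x, hx⟩).2⟩, (hF M ⟨x, hx⟩ _).2 rfl⟩
  exact ⟨Quotient.mk _ ⟨_, isFunctional_of_graph f hF'⟩, fun M x => eval_mk f hF' _ x⟩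

/-- The functions are chosen model by model outside the theory, which is harmless: uniqueness makes
`F` define their graphs uniformly. -/
theorem exists_hom_of_existsUnique {X Y : SynCat T} (F : Fml (X.arity + Y.arity))
    (hF : ∀ (M : Mod T) (x : X.Pts M), ∃! y : Y.Pts M, Sat F (Fin.append x.1 y.1)) :
    ∃ φ : X ⟶ Y, ∀ (M : Mod T) (x : X.Pts M), Sat F (Fin.append x.1 (eval φ x).1) := by
  choose f hf using hF
  obtain ⟨φ, hφ⟩ := exists_hom f F fun M x y =>
    ⟨fun h => ((hf M x).2 y h).symm, fun h => h ▸ (hf M x).1⟩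
  exact ⟨φ, fun M x => by rw [hφ]; exact (hf M x).1⟩

/-! ### Universal properties, checked in the models -/

/-- Joint injectivity of p and q makes the required point w unique. Its dependence on z is therefore
definable, by the formula stating p(w) = f(z) and q(w) = g(z). -/
theorem exists_lift {W X Y Z : SynCat T} {p : W ⟶ X} {q : W ⟶ Y}
    (inj : ∀ (M : Mod T) (w w' : W.Pts M), eval p w = eval p w' → eval q w = eval q w' → w = w')
    (f : Z ⟶ X) (g : Z ⟶ Y)
    (h : ∀ (M : Mod T) (z : Z.Pts M), ∃ w : W.Pts M, eval p w = eval f z ∧ eval q w = eval g z) :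
    ∃ k : Z ⟶ W, k ≫ p = f ∧ k ≫ q = g := by
  choose k hk using h
  obtain ⟨P, hP⟩ := exists_formula p
  obtain ⟨Q, hQ⟩ := exists_formula q
  obtain ⟨F, hF⟩ := exists_formula f
  obtain ⟨G, hG⟩ := exists_formula g
  obtain ⟨φ, hφ⟩ := exists_hom k
    ((exN X.arity (ren (Fin.append (Fin.castAdd _ ∘ Fin.castAdd _) (Fin.natAdd _)) F ⊓
        ren (Fin.append (Fin.castAdd _ ∘ Fin.natAdd _) (Fin.natAdd _)) P)) ⊓
      (exN Y.arity (ren (Fin.append (Fin.castAdd _ ∘ Fin.castAdd _) (Fin.natAdd _)) G ⊓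
        ren (Fin.append (Fin.castAdd _ ∘ Fin.natAdd _) (Fin.natAdd _)) Q))) (by
    intro M z w
    simp only [sat_exN, sat_and, sat_ren, comp_fin_append, ← Function.comp_assoc,
      fin_append_comp_castAdd, fin_append_comp_natAdd, hP, hQ, hF, hG]
    constructor
    · rintro ⟨⟨x, ⟨_, h1⟩, ⟨_, h2⟩⟩, y, ⟨_, h3⟩, ⟨_, h4⟩⟩
      refine inj M _ _ ((hk M z).1.trans ?_) ((hk M z).2.trans ?_)
      · exact Subtype.ext (h1.trans h2.symm)
      · exact Subtype.ext (h3.trans h4.symm)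
    · rintro rfl
      exact ⟨⟨_, ⟨z.2, rfl⟩, ⟨(k M z).2, congrArg Subtype.val (hk M z).1⟩⟩,
        ⟨_, ⟨z.2, rfl⟩, ⟨(k M z).2, congrArg Subtype.val (hk M z).2⟩⟩⟩)
  exact ⟨φ, hom_ext fun M z => by rw [eval_comp, hφ, (hk M z).1],
    hom_ext fun M z => by rw [eval_comp, hφ, (hk M z).2]⟩

theorem isProduct_of_bijective {W X Y : SynCat T} {p : W ⟶ X} {q : W ⟶ Y}
    (inj : ∀ (M : Mod T) (w w' : W.Pts M), eval p w = eval p w' → eval q w = eval q w' → w = w')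
    (surj : ∀ (M : Mod T) (x : X.Pts M) (y : Y.Pts M), ∃ w : W.Pts M, eval p w = x ∧ eval q w = y) :
    IsProduct p q := by
  have h {Z : SynCat T} (f : Z ⟶ X) (g : Z ⟶ Y) := exists_lift inj f g fun M z => surj M _ _
  choose l hl using @h
  refine ⟨BinaryFan.IsLimit.mk _ l (fun f g => (hl f g).1) (fun f g => (hl f g).2) ?_⟩
  rintro Z _ _ m rfl rfl
  refine hom_ext fun M z => inj M _ _ ?_ ?_
  · simpa using congrArg (eval · z) (hl (m ≫ p) (m ≫ q)).1.symm
  · simpa using congrArg (eval · z) (hl (m ≫ p) (m ≫ q)).2.symm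

theorem isPullback_of_bijective {W X Y B : SynCat T} {p : W ⟶ X} {q : W ⟶ Y} {f : X ⟶ B}
    {g : Y ⟶ B} (w : p ≫ f = q ≫ g)
    (inj : ∀ (M : Mod T) (w w' : W.Pts M), eval p w = eval p w' → eval q w = eval q w' → w = w')
    (surj : ∀ (M : Mod T) (x : X.Pts M) (y : Y.Pts M), eval f x = eval g y →
      ∃ w : W.Pts M, eval p w = x ∧ eval q w = y) : IsPullback p q f g := by
  refine ⟨⟨w⟩, ⟨PullbackCone.isLimitAux' _ fun s => ?_⟩⟩
  have h := exists_lift inj s.fst s.snd fun M z =>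
    surj M _ _ (by simpa using congrArg (eval · z) s.condition)
  refine ⟨h.choose, h.choose_spec.1, h.choose_spec.2, fun {m} h1 h2 => hom_ext fun M z =>
    inj M _ _ ?_ ?_⟩
  · exact (eval_comp m p z).symm.trans ((congrArg (eval · z) (h1.trans h.choose_spec.1.symm)).trans
      (eval_comp _ p z))
  · exact (eval_comp m q z).symm.trans ((congrArg (eval · z) (h2.trans h.choose_spec.2.symm)).trans
      (eval_comp _ q z))

/-- The kernel pair of f is an object K, in a context of twice the length. Its projections become
equal after f, hence are equal, and evaluating them at the point (x, x') gives the claim. -/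
theorem eval_injective_of_mono {X Y : SynCat T} (f : X ⟶ Y) [Mono f] {M : Mod T} {x x' : X.Pts M}
    (h : eval f x = eval f x') : x = x' := by
  obtain ⟨F, hF⟩ := exists_formula f
  let K : SynCat T := ⟨X.arity + X.arity, exN Y.arity
    (ren (Fin.append (Fin.castAdd _ ∘ Fin.castAdd _) (Fin.natAdd _)) F ⊓
      ren (Fin.append (Fin.castAdd _ ∘ Fin.natAdd _) (Fin.natAdd _)) F)⟩
  have hK : ∀ (M : Mod T) x x', Sat K.formula (Fin.append x x' : _ → M) ↔
      ∃ h h', eval f ⟨x, h⟩ = eval f ⟨x', h'⟩ := by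
    intro M x x'
    simp only [K, sat_exN, sat_and, sat_ren, comp_fin_append, ← Function.comp_assoc,
      fin_append_comp_castAdd, fin_append_comp_natAdd, hF]
    constructor
    · rintro ⟨y, ⟨h1, h2⟩, h3, h4⟩
      exact ⟨h1, h3, Subtype.ext (h2.trans h4.symm)⟩
    · rintro ⟨h1, h2, h⟩
      exact ⟨_, ⟨h1, rfl⟩, h2, congrArg Subtype.val h.symm⟩
  have hK' : ∀ (M : Mod T) (v : K.Pts M), ∃ h h', eval f ⟨v.1 ∘ Fin.castAdd X.arity, h⟩ =
      eval f ⟨v.1 ∘ Fin.natAdd X.arity, h'⟩ := fun M v => by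
    have e : Fin.append (v.1 ∘ Fin.castAdd X.arity) (v.1 ∘ Fin.natAdd X.arity) = v.1 :=
      Fin.append_castAdd_natAdd
    exact (hK M _ _).1 (e.symm ▸ v.2)
  choose h1 h2 h3 using hK'
  obtain ⟨p, hp⟩ := exists_hom (X := K) (Y := X) (fun M v => ⟨v.1 ∘ Fin.castAdd _, h1 M v⟩)
    (eqs (Fin.castAdd _ ∘ Fin.castAdd _) (Fin.natAdd _)) (by
      intro M v y
      rw [sat_eqs, ← Function.comp_assoc, fin_append_comp_castAdd, fin_append_comp_natAdd]
      exact ⟨fun h => Subtype.ext h, congrArg Subtype.val⟩)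
  obtain ⟨q, hq⟩ := exists_hom (X := K) (Y := X) (fun M v => ⟨v.1 ∘ Fin.natAdd _, h2 M v⟩)
    (eqs (Fin.castAdd _ ∘ Fin.natAdd _) (Fin.natAdd _)) (by
      intro M v y
      rw [sat_eqs, ← Function.comp_assoc, fin_append_comp_castAdd, fin_append_comp_natAdd]
      exact ⟨fun h => Subtype.ext h, congrArg Subtype.val⟩)
  have e : p = q := (cancel_mono f).1 (hom_ext fun M v => by
    rw [eval_comp, eval_comp, hp, hq, h3])
  let v : K.Pts M := ⟨Fin.append x.1 x'.1, (hK M _ _).2 ⟨x.2, x'.2, h⟩⟩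
  have := congrArg Subtype.val ((hp M v).symm.trans ((congrArg (eval · v) e).trans (hq M v)))
  refine Subtype.ext ?_
  exact (fin_append_comp_castAdd x.1 x'.1).symm.trans
    (this.trans (fin_append_comp_natAdd x.1 x'.1))

theorem nonempty_isTerminal {X : SynCat T} (h : ∀ M : Mod T, ∃! _ : X.Pts M, True) :
    Nonempty (IsTerminal X) := by
  have h' (Z : SynCat T) : ∃ f : Z ⟶ X, ∀ g, g = f := by
    -- When the target has one point, the true formula already has a unique solution.
    obtain ⟨f, -⟩ := exists_hom_of_existsUnique (X := Z) (Y := X) ⊤ fun M _ => by simpa using h M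
    exact ⟨f, fun g => hom_ext fun M x => (h M).unique trivial trivial⟩
  choose f hf using h'
  exact ⟨IsTerminal.ofUniqueHom f hf⟩

end SynCat

/-! ### Set theory in the models of ZF -/

theorem comp_vec_one {A B : Type*} (f : A → B) (a : A) : f ∘ ![a] = ![f a] := by
  funext i
  fin_cases i
  rfl

theorem comp_vec_two {A B : Type*} (f : A → B) (a b : A) : f ∘ ![a, b] = ![f a, f b] := by
  funext i
  fin_cases i <;> rfl

section Models

variable {M : Mod ZF}

theorem sat_of_mem_ZF {σ : setLang.Sentence} (h : σ ∈ ZF) : Sat (M := M) (n := 0) σ Fin.elim0 :=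
  models_iff_sat.1 M.is_model σ h

theorem mem_ext {a b : M} (h : ∀ t, Mem t a ↔ Mem t b) : a = b := by
  have := sat_of_mem_ZF (M := M) (σ := extensionality) (by simp [ZF])
  simp [extensionality, Fin.snoc] at this
  exact this a b h

theorem exists_upair (a b : M) : ∃ c, ∀ t, Mem t c ↔ t = a ∨ t = b := by
  have := sat_of_mem_ZF (M := M) (σ := pairing) (by simp [ZF])
  simp [pairing, Fin.snoc] at this
  exact this a b

theorem exists_sUnion (a : M) : ∃ c, ∀ t, Mem t c ↔ ∃ y, Mem t y ∧ Mem y a := by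
  have := sat_of_mem_ZF (M := M) (σ := union) (by simp [ZF])
  simp [union, Fin.snoc] at this
  exact this a

theorem exists_powerset (a : M) : ∃ c, ∀ t, Mem t c ↔ ∀ y, Mem y t → Mem y a := by
  have := sat_of_mem_ZF (M := M) (σ := powerset) (by simp [ZF])
  simp [powerset, Fin.snoc] at this
  exact this a

theorem snoc_snoc_snoc_eq_append {A : Type*} {n : ℕ} (p : Fin n → A) (a b c : A) :
    (Fin.snoc (Fin.snoc (Fin.snoc p a : Fin (n + 1) → A) b : Fin (n + 2) → A) c : Fin (n + 3) → A) =
      Fin.append p ![a, b, c] := by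
  have : ![a, b, c] = (Fin.snoc (Fin.snoc (Fin.snoc ![] a : Fin 1 → A) b : Fin 2 → A) c :
      Fin 3 → A) := by
    funext i
    fin_cases i <;> rfl
  rw [this, Fin.append_snoc, Fin.append_snoc, Fin.append_snoc]
  congr 3
  funext i
  exact (Fin.append_left p _ i).symm

theorem exists_sep {n : ℕ} (φ : Fml (n + 1)) (p : Fin n → M) (a : M) :
    ∃ b, ∀ t, Mem t b ↔ Mem t a ∧ Sat φ (Fin.snoc p t : Fin (n + 1) → M) := by
  have h : M ⊨ separation n φ := M.is_model.realize_of_mem _ (Or.inl (Or.inr ⟨n, φ, rfl⟩))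
  have h : ∀ p : Fin n → M, Sat (∀' ∃' ∀' (memP 3 2 1 ⇔ (memP 3 2 0 ⊓ withParams 3 ![2] φ))) p :=
    BoundedFormula.realize_alls.1 h
  have := h p
  simp only [sat_all, sat_ex, sat_iff, sat_and] at this
  obtain ⟨b, hb⟩ := this a
  refine ⟨b, fun t => ?_⟩
  have := hb t
  erw [snoc_snoc_snoc_eq_append] at this
  simp only [memP, withParams, sat_memF, sat_ren, comp_fin_append, fin_append_comp_castAdd,
    ← Function.comp_assoc, fin_append_comp_natAdd, Fin.append_right] at this
  have e : (Fin.snoc p t : Fin (n + 1) → M) = Fin.append p (![a, b, t] ∘ ![2]) := by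
    rw [Fin.snoc_eq_append]
    congr 1
    funext i
    fin_cases i
    rfl
  rw [e]
  exact this

/-- The form in which separation is used: to form a set it suffices to bound the class. -/
theorem exists_set_of_bounded {n : ℕ} (φ : Fml (n + 1)) (p : Fin n → M) {a : M}
    (h : ∀ t, Sat φ (Fin.snoc p t : Fin (n + 1) → M) → Mem t a) :
    ∃ b, ∀ t, Mem t b ↔ Sat φ (Fin.snoc p t : Fin (n + 1) → M) := by
  obtain ⟨b, hb⟩ := exists_sep φ p a
  exact ⟨b, fun t => (hb t).trans ⟨And.right, fun ht => ⟨h t ht, ht⟩⟩⟩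

theorem exists_empty (M : Mod ZF) : ∃ a : M, ∀ t, ¬Mem t a := by
  obtain ⟨a⟩ := M.nonempty'
  obtain ⟨b, hb⟩ := exists_sep (⊥ : Fml 1) Fin.elim0 a
  exact ⟨b, fun t ht => ((hb t).1 ht).2⟩

/-- The empty set of a model of ZF. -/
noncomputable def empty (M : Mod ZF) : M := (exists_empty M).choose

/-- The unordered pair of two elements of a model of ZF. -/
noncomputable def upair (a b : M) : M := (exists_upair a b).choose

/-- The ordered pair of two elements of a model of ZF. -/
noncomputable def opair (a b : M) : M := upair (upair a a) (upair a b)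

/-- The number `1` of a model of ZF. -/
noncomputable def one (M : Mod ZF) : M := upair (empty M) (empty M)

@[simp] theorem not_mem_empty (t : M) : ¬Mem t (empty M) := (exists_empty M).choose_spec t

@[simp] theorem mem_upair {a b t : M} : Mem t (upair a b) ↔ t = a ∨ t = b :=
  (exists_upair a b).choose_spec t

theorem mem_ext_iff {a b : M} : a = b ↔ ∀ t, Mem t a ↔ Mem t b :=
  ⟨fun h _ => h ▸ Iff.rfl, mem_ext⟩

theorem one_ne_empty : one M ≠ empty M := fun h => by
  have : Mem (empty M) (one M) := mem_upair.2 (Or.inl rfl)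
  rw [h] at this
  exact not_mem_empty _ this

theorem upair_eq_upair_iff {a b c d : M} :
    upair a b = upair c d ↔ a = c ∧ b = d ∨ a = d ∧ b = c := by
  constructor
  · intro h
    have h1 : ∀ t, t = a ∨ t = b ↔ t = c ∨ t = d := by simpa using mem_ext_iff.1 h
    have ha := (h1 a).1 (Or.inl rfl)
    have hb := (h1 b).1 (Or.inr rfl)
    have hc := (h1 c).2 (Or.inl rfl)
    have hd := (h1 d).2 (Or.inr rfl)
    grind
  · rintro (⟨rfl, rfl⟩ | ⟨rfl, rfl⟩)
    · rfl
    · exact mem_ext fun t => by simp [or_comm]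

@[simp] theorem opair_eq_opair_iff {a b c d : M} : opair a b = opair c d ↔ a = c ∧ b = d := by
  simp only [opair, upair_eq_upair_iff]
  grind

@[simp] theorem sat_emptyF (v : Fin 1 → M) : Sat emptyF v ↔ v 0 = empty M := by
  simp [emptyF, Fin.snoc, mem_ext_iff]

@[simp] theorem sat_oneF (v : Fin 1 → M) : Sat oneF v ↔ v 0 = one M := by
  simp [oneF, Fin.snoc, mem_ext_iff (a := v 0), one]

@[simp] theorem sat_singletonF (v : Fin 2 → M) : Sat singletonF v ↔ v 0 = upair (v 1) (v 1) := by
  simp [singletonF, Fin.snoc, mem_ext_iff (b := upair _ _)]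

@[simp] theorem sat_unorderedPairF (v : Fin 3 → M) :
    Sat unorderedPairF v ↔ v 0 = upair (v 1) (v 2) := by
  simp [unorderedPairF, Fin.snoc, mem_ext_iff (b := upair _ _)]
  rfl

@[simp] theorem sat_pairF (v : Fin 3 → M) : Sat pairF v ↔ v 0 = opair (v 1) (v 2) := by
  simp [pairF, Fin.snoc, opair, mem_ext_iff (a := v 0)]
  rfl

@[simp] theorem sat_pairMemF (v : Fin 3 → M) : Sat pairMemF v ↔ Mem (opair (v 0) (v 1)) (v 2) := by
  simp [pairMemF, Fin.snoc]
  rfl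

@[simp] theorem sat_memDomF (v : Fin 2 → M) :
    Sat memDomF v ↔ ∃ y, Mem (opair (v 0) y) (v 1) := by
  simp [memDomF, Fin.snoc]

@[simp] theorem sat_memRanF (v : Fin 2 → M) :
    Sat memRanF v ↔ ∃ x, Mem (opair x (v 0)) (v 1) := by
  simp [memRanF, Fin.snoc]

@[simp] theorem sat_funF (v : Fin 1 → M) : Sat funF v ↔
    (∀ t, Mem t (v 0) → ∃ x y, t = opair x y) ∧
      ∀ x y y', Mem (opair x y) (v 0) → Mem (opair x y') (v 0) → y = y' := by
  simp [funF, Fin.snoc]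

/-- For x in a and y in b, both {x} and {x, y} are subsets of a ∪ b, so ⟨x, y⟩ lies in the second
power set of a ∪ b, from which the product is separated. -/
theorem exists_prod (a b : M) : ∃ c, ∀ t, Mem t c ↔ ∃ x y, t = opair x y ∧ Mem x a ∧ Mem y b := by
  obtain ⟨u, hu⟩ := exists_sUnion (upair a b)
  obtain ⟨v, hv⟩ := exists_powerset u
  obtain ⟨w, hw⟩ := exists_powerset v
  obtain ⟨c, hc⟩ := exists_set_of_bounded (a := w)
    (∃' ∃' (ren ![2, 3, 4] pairF ⊓ memF 3 0 ⊓ memF 4 1)) ![a, b] (by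
      intro t
      simp only [sat_ex, sat_and, sat_ren, sat_pairF, sat_memF]
      rintro ⟨x, y, ⟨ht, hx⟩, hy⟩
      have ht : t = opair x y := ht
      have hx : Mem x a := hx
      have hy : Mem y b := hy
      subst ht
      have hxu : Mem x u := (hu x).2 ⟨a, hx, by simp⟩
      have hyu : Mem y u := (hu y).2 ⟨b, hy, by simp⟩
      refine (hw _).2 fun s hs => (hv _).2 fun r hr => ?_
      rw [opair, mem_upair] at hs
      rcases hs with rfl | rfl <;> rw [mem_upair] at hr <;> rcases hr with rfl | rfl <;> assumption)
  refine ⟨c, fun t => (hc t).trans ?_⟩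
  simp [and_assoc]

end Models

/-! ### Which classes are sets -/

theorem isDefinableSet_iff {P : Fml 1} :
    IsDefinableSet P ↔ ∀ M : Mod ZF, ∃ a : M, ∀ x, Mem x a ↔ Sat P ![x] := by
  rw [IsDefinableSet, derives_iff]
  refine forall_congr' fun M => ?_
  simp [Fin.snoc, comp_vec_one]

/-- A provable subclass of a set is a set. -/
theorem isDefinableSet_of_bounded {P : Fml 1}
    (h : ∀ M : Mod ZF, ∃ a : M, ∀ x, Sat P ![x] → Mem x a) : IsDefinableSet P := by
  refine isDefinableSet_iff.2 fun M => ?_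
  have e (x : M) : (Fin.snoc ![] x : Fin 1 → M) = ![x] := by
    funext i
    fin_cases i
    rfl
  obtain ⟨a, ha⟩ := h M
  obtain ⟨b, hb⟩ := exists_set_of_bounded P ![] (a := a) fun t ht => ha t (by rwa [e] at ht)
  exact ⟨b, fun x => (hb x).trans (by rw [e])⟩

theorem isDefinableSet_emptyF : IsDefinableSet emptyF :=
  isDefinableSet_of_bounded fun M => ⟨one M, by simp [one]⟩

theorem isDefinableSet_omegaFml : IsDefinableSet omegaFml :=
  isDefinableSet_of_bounded fun M => ⟨upair (empty M) (one M), by simp [omegaFml]⟩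

@[simp] theorem sat_prodFml {M : Mod ZF} (P Q : Fml 1) (v : Fin 1 → M) : Sat (prodFml P Q) v ↔
    ∃ x y, v 0 = opair x y ∧ Sat P ![x] ∧ Sat Q ![y] := by
  simp [prodFml, Fin.snoc, and_assoc, comp_vec_one]

@[simp] theorem sat_expFml {M : Mod ZF} (P Q : Fml 1) (v : Fin 1 → M) : Sat (expFml P Q) v ↔
    ((∀ t, Mem t (v 0) → ∃ x y, t = opair x y) ∧
      ∀ x y y', Mem (opair x y) (v 0) → Mem (opair x y') (v 0) → y = y') ∧
    (∀ x, (∃ y, Mem (opair x y) (v 0)) ↔ Sat P ![x]) ∧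
    ∀ y, (∃ x, Mem (opair x y) (v 0)) → Sat Q ![y] := by
  simp [expFml, Fin.snoc, and_assoc, comp_vec_one]

theorem isDefinableSet_prodFml {P Q : Fml 1} (hP : IsDefinableSet P) (hQ : IsDefinableSet Q) :
    IsDefinableSet (prodFml P Q) := by
  refine isDefinableSet_iff.2 fun M => ?_
  obtain ⟨a, ha⟩ := isDefinableSet_iff.1 hP M
  obtain ⟨b, hb⟩ := isDefinableSet_iff.1 hQ M
  obtain ⟨c, hc⟩ := exists_prod a b
  exact ⟨c, fun x => by simp [hc, ha, hb]⟩

/-- A function between two sets is a subset of their product, so all of them belong to the power set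
of the product. -/
theorem isDefinableSet_expFml {P Q : Fml 1} (hP : IsDefinableSet P) (hQ : IsDefinableSet Q) :
    IsDefinableSet (expFml P Q) := by
  refine isDefinableSet_of_bounded fun M => ?_
  obtain ⟨a, ha⟩ := isDefinableSet_iff.1 hP M
  obtain ⟨b, hb⟩ := isDefinableSet_iff.1 hQ M
  obtain ⟨c, hc⟩ := exists_prod a b
  obtain ⟨d, hd⟩ := exists_powerset c
  refine ⟨d, fun f hf => (hd f).2 fun t ht => ?_⟩
  rw [sat_expFml] at hf
  obtain ⟨⟨h1, -⟩, h2, h3⟩ := hf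
  obtain ⟨x, y, rfl⟩ := h1 t ht
  exact (hc _).2 ⟨x, y, rfl, (ha x).2 ((h2 x).1 ⟨y, ht⟩), (hb y).2 (h3 y ⟨x, ht⟩)⟩

/-! ### Arrows of definable sets -/

theorem append_eq_vec_two {A : Type*} (x y : Fin 1 → A) : Fin.append x y = ![x 0, y 0] := by
  funext i
  fin_cases i <;> rfl

theorem eq_vec_one {A : Type*} (x : Fin 1 → A) : x = ![x 0] := by
  funext i
  fin_cases i
  rfl

namespace DST

open SynCat

/-- The elements of a definable set in a model of ZF. -/
abbrev Pts (X : DST) (M : Mod ZF) := {a : M // Sat X.fml ![a]}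

/-- The elements of a definable set, as tuples of length one. -/
def ptsEquiv (X : DST) (M : Mod ZF) : X.Pts M ≃ (inclusion.obj X).Pts M where
  toFun a := ⟨![a.1], a.2⟩
  invFun v := ⟨v.1 (0 : Fin 1), (congrArg (Sat X.fml) (eq_vec_one (A := M) v.1)).mp v.2⟩
  left_inv _ := rfl
  right_inv v := Subtype.ext (eq_vec_one v.1).symm

/-- The function between definable sets denoted by an arrow in a model of ZF. -/
noncomputable def eval {X Y : DST} (f : X ⟶ Y) {M : Mod ZF} (x : X.Pts M) : Y.Pts M :=
  (Y.ptsEquiv M).symm (SynCat.eval (inclusion.map f) (X.ptsEquiv M x))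

theorem eval_ptsEquiv {X Y : DST} (f : X ⟶ Y) {M : Mod ZF} (x : X.Pts M) :
    SynCat.eval (inclusion.map f) (X.ptsEquiv M x) = Y.ptsEquiv M (eval f x) := by
  rw [eval, Equiv.apply_symm_apply]

theorem hom_ext {X Y : DST} {f g : X ⟶ Y} (h : ∀ (M : Mod ZF) (x : X.Pts M), eval f x = eval g x) :
    f = g := by
  refine inclusion.map_injective (SynCat.hom_ext fun M x => ?_)
  obtain ⟨x, rfl⟩ := (X.ptsEquiv M).surjective x
  rw [eval_ptsEquiv, eval_ptsEquiv, h]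

@[simp] theorem eval_id (X : DST) {M : Mod ZF} (x : X.Pts M) : eval (𝟙 X) x = x := by
  rw [eval, CategoryTheory.Functor.map_id, SynCat.eval_id, Equiv.symm_apply_apply]

@[simp] theorem eval_comp {X Y Z : DST} (f : X ⟶ Y) (g : Y ⟶ Z) {M : Mod ZF} (x : X.Pts M) :
    eval (f ≫ g) x = eval g (eval f x) := by
  rw [eval, Functor.map_comp, SynCat.eval_comp, eval_ptsEquiv, eval_ptsEquiv,
    Equiv.symm_apply_apply]

/-- A formula that defines the graph of a function in every model is the formula of an arrow. -/
theorem exists_isClassOf {X Y : DST} (F : Fml (1 + 1))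
    (typed : ∀ (M : Mod ZF) (a b : M), Sat F ![a, b] → Sat X.fml ![a] ∧ Sat Y.fml ![b])
    (eu : ∀ (M : Mod ZF) (a : M), Sat X.fml ![a] → ∃! b : M, Sat F ![a, b]) :
    ∃ f : X ⟶ Y, IsClassOf f F ∧ ∀ (M : Mod ZF) (x : X.Pts M), Sat F ![x.1, (eval f x).1] := by
  have h : IsFunctional (inclusion.obj X) (inclusion.obj Y) F := by
    refine isFunctional_iff.2 fun M => ⟨fun (x y : Fin 1 → M) h => ?_,
      fun (x y y' : Fin 1 → M) h h' => ?_, fun (x : Fin 1 → M) h => ?_⟩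
    · erw [append_eq_vec_two] at h
      rw [eq_vec_one x, eq_vec_one y]
      exact typed M _ _ h
    · erw [append_eq_vec_two] at h h'
      rw [eq_vec_one y, eq_vec_one y']
      exact congrArg (fun c => ![c]) ((eu M _ (typed M _ _ h).1).unique h h')
    · rw [eq_vec_one x] at h ⊢
      obtain ⟨b, hb, -⟩ := eu M _ h
      refine ⟨![b], ?_⟩
      erw [append_eq_vec_two]
      exact hb
  refine ⟨inclusion.preimage (Quotient.mk (funRelSetoid _ _) ⟨F, h⟩), ⟨h, inclusion.map_preimage _⟩, fun M x => ?_⟩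
  have : Graph (inclusion.map (inclusion.preimage (Quotient.mk (funRelSetoid _ _) ⟨F, h⟩))) M
    (X.ptsEquiv M x).1 _ := (graph_iff _).2 ⟨(X.ptsEquiv M x).2, rfl⟩
  rw [Subtype.coe_eta, eval_ptsEquiv, inclusion.map_preimage] at this
  have : Sat F (Fin.append ![x.1] ![(eval (inclusion.preimage _) x).1]) := this
  rwa [append_eq_vec_two] at this

theorem exists_hom {X Y : DST} (F : Fml 2)
    (eu : ∀ (M : Mod ZF) (x : X.Pts M), ∃! y : Y.Pts M, Sat F ![x.1, y.1]) :
    ∃ f : X ⟶ Y, ∀ (M : Mod ZF) (x : X.Pts M), Sat F ![x.1, (eval f x).1] := by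
  obtain ⟨f, -, hf⟩ := exists_isClassOf (X := X) (Y := Y) (ren ![0] X.fml ⊓ ren ![1] Y.fml ⊓ F)
    (fun M a b h => by
      have := ((sat_and _ _ _).1 h).1
      simpa [comp_vec_one] using this) (fun M a ha => by
      obtain ⟨b, hb, hu⟩ := eu M ⟨a, ha⟩
      refine ⟨b.1, ?_, fun c hc => ?_⟩
      · simpa [comp_vec_one, ha, b.2] using hb
      · have : Sat Y.fml ![c] ∧ Sat F ![a, c] := by simpa [comp_vec_one, ha] using hc
        exact congrArg Subtype.val (hu ⟨c, this.1⟩ this.2))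
  exact ⟨f, fun M x => ((sat_and _ _ _).1 (hf M x)).2⟩

theorem exists_formula {X Y : DST} (f : X ⟶ Y) : ∃ F : Fml 2, ∀ (M : Mod ZF) (a b : M),
    Sat F ![a, b] ↔ ∃ h, (eval f ⟨a, h⟩).1 = b := by
  obtain ⟨F, hF⟩ := SynCat.exists_formula (inclusion.map f)
  refine ⟨F, fun M a b => ?_⟩
  have := hF M ![a] ![b]
  erw [append_eq_vec_two] at this
  refine this.trans (exists_congr fun h => ?_)
  have := congrArg Subtype.val (eval_ptsEquiv f ⟨a, h⟩)
  refine (Eq.congr_left this).trans ⟨fun h => congrFun h (0 : Fin 1), fun h => congrArg (fun c => ![c]) h⟩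

/-! ### Finite limits -/

/-- Stating the conclusion after the inclusion serves two purposes: a fully faithful functor
reflects the limit back to definable sets, and the limit is seen to be preserved. -/
theorem isPullback_map_of_bijective {W X Y B : DST} {p : W ⟶ X} {q : W ⟶ Y} {f : X ⟶ B} {g : Y ⟶ B}
    (w : p ≫ f = q ≫ g)
    (inj : ∀ (M : Mod ZF) (w w' : W.Pts M), eval p w = eval p w' → eval q w = eval q w' → w = w')
    (surj : ∀ (M : Mod ZF) (x : X.Pts M) (y : Y.Pts M), eval f x = eval g y →
      ∃ w : W.Pts M, eval p w = x ∧ eval q w = y) :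
    IsPullback (inclusion.map p) (inclusion.map q) (inclusion.map f) (inclusion.map g) := by
  refine isPullback_of_bijective (by rw [← Functor.map_comp, w, Functor.map_comp]) ?_ ?_
  · intro M w w' h1 h2
    obtain ⟨w, rfl⟩ := (W.ptsEquiv M).surjective w
    obtain ⟨w', rfl⟩ := (W.ptsEquiv M).surjective w'
    simp only [eval_ptsEquiv, EmbeddingLike.apply_eq_iff_eq] at h1 h2 ⊢
    exact inj M w w' h1 h2
  · intro M x y h
    obtain ⟨x, rfl⟩ := (X.ptsEquiv M).surjective x
    obtain ⟨y, rfl⟩ := (Y.ptsEquiv M).surjective y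
    simp only [eval_ptsEquiv, EmbeddingLike.apply_eq_iff_eq] at h
    obtain ⟨w, rfl, rfl⟩ := surj M x y h
    exact ⟨W.ptsEquiv M w, eval_ptsEquiv _ _, eval_ptsEquiv _ _⟩

theorem isProduct_map_of_bijective {W X Y : DST} {p : W ⟶ X} {q : W ⟶ Y}
    (inj : ∀ (M : Mod ZF) (w w' : W.Pts M), eval p w = eval p w' → eval q w = eval q w' → w = w')
    (surj : ∀ (M : Mod ZF) (x : X.Pts M) (y : Y.Pts M), ∃ w, eval p w = x ∧ eval q w = y) :
    IsProduct (inclusion.map p) (inclusion.map q) := by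
  refine isProduct_of_bijective ?_ ?_
  · intro M w w' h1 h2
    obtain ⟨w, rfl⟩ := (W.ptsEquiv M).surjective w
    obtain ⟨w', rfl⟩ := (W.ptsEquiv M).surjective w'
    simp only [eval_ptsEquiv, EmbeddingLike.apply_eq_iff_eq] at h1 h2 ⊢
    exact inj M w w' h1 h2
  · intro M x y
    obtain ⟨x, rfl⟩ := (X.ptsEquiv M).surjective x
    obtain ⟨y, rfl⟩ := (Y.ptsEquiv M).surjective y
    obtain ⟨w, rfl, rfl⟩ := surj M x y
    exact ⟨W.ptsEquiv M w, eval_ptsEquiv _ _, eval_ptsEquiv _ _⟩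

theorem isProduct_of_map {W X Y : DST} {p : W ⟶ X} {q : W ⟶ Y}
    (h : IsProduct (inclusion.map p) (inclusion.map q)) : IsProduct p q :=
  h.map fun h => isLimitOfReflectsOfMapIsLimit inclusion p q h

theorem existsUnique_pts_emptyF (h : IsDefinableSet emptyF) (M : Mod ZF) :
    ∃! _ : (of emptyF h).Pts M, True :=
  ⟨⟨empty M, (sat_emptyF _).2 rfl⟩, trivial, fun x _ => Subtype.ext ((sat_emptyF _).1 x.2)⟩

theorem isTerminal_map_emptyF (h : IsDefinableSet emptyF) :
    Nonempty (IsTerminal (inclusion.obj (of emptyF h))) := by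
  refine nonempty_isTerminal fun M => ?_
  obtain ⟨x, -, hx⟩ := existsUnique_pts_emptyF h M
  exact ⟨ptsEquiv _ M x, trivial, fun y _ => ((ptsEquiv _ M).symm_apply_eq).1 (hx _ trivial)⟩

theorem isTerminal_emptyF (h : IsDefinableSet emptyF) : Nonempty (IsTerminal (of emptyF h)) :=
  (isTerminal_map_emptyF h).map fun h => h.isTerminalOfObj inclusion _

/-- The pullback is the class of pairs ⟨x, y⟩ with f(x) = g(y), a subclass of the product set and
hence a set. -/
theorem exists_pullback {X Y B : DST} (f : X ⟶ B) (g : Y ⟶ B) :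
    ∃ (W : DST) (p : W ⟶ X) (q : W ⟶ Y),
      IsPullback (inclusion.map p) (inclusion.map q) (inclusion.map f) (inclusion.map g) := by
  obtain ⟨F, hF⟩ := exists_formula f
  obtain ⟨G, hG⟩ := exists_formula g
  let P : Fml 1 := ∃' ∃' ∃' (ren ![0, 1, 2] pairF ⊓ ren ![1, 3] F ⊓ ren ![2, 3] G)
  have hP (M : Mod ZF) (a : M) : Sat P ![a] ↔
      ∃ (x : X.Pts M) (y : Y.Pts M), a = opair x.1 y.1 ∧ eval f x = eval g y := by
    simp only [P, sat_ex, sat_and, sat_ren, comp_vec_two, hF, hG, sat_pairF]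
    constructor
    · rintro ⟨x, y, b, ⟨ha, hx, hfx⟩, hy, hgy⟩
      exact ⟨⟨x, hx⟩, ⟨y, hy⟩, ha, Subtype.ext (hfx.trans hgy.symm)⟩
    · rintro ⟨x, y, ha, h⟩
      exact ⟨x.1, y.1, _, ⟨ha, x.2, rfl⟩, y.2, congrArg Subtype.val h.symm⟩
  have h : IsDefinableSet P := isDefinableSet_of_bounded fun M => by
    obtain ⟨a, ha⟩ := isDefinableSet_iff.1 (isDefinableSet_prodFml X.property Y.property) M
    refine ⟨a, fun z hz => (ha z).2 ((sat_prodFml _ _ _).2 ?_)⟩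
    obtain ⟨x, y, rfl, -⟩ := (hP M z).1 hz
    exact ⟨_, _, rfl, x.2, y.2⟩
  obtain ⟨p, hp⟩ := exists_hom (X := of P h) (Y := X) (∃' (ren ![0, 1, 2] pairF)) fun M w => by
    obtain ⟨x, y, hw, -⟩ := (hP M w.1).1 w.2
    refine ⟨x, ?_, fun x' hx' => ?_⟩
    · simp [hw]
    · simp [hw] at hx'
      exact Subtype.ext hx'.symm
  -- Here variable 1 is the value y, and the bound variable 2 is the first component; hence the
  -- swap.
  obtain ⟨q, hq⟩ := exists_hom (X := of P h) (Y := Y) (∃' (ren ![0, 2, 1] pairF)) fun M w => by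
    obtain ⟨x, y, hw, -⟩ := (hP M w.1).1 w.2
    refine ⟨y, ?_, fun y' hy' => ?_⟩
    · simp [hw]
    · simp [hw] at hy'
      exact Subtype.ext hy'.symm
  have key (M : Mod ZF) (w : (of P h).Pts M) : w.1 = opair (eval p w).1 (eval q w).1 ∧
      eval f (eval p w) = eval g (eval q w) := by
    obtain ⟨x, y, hw, he⟩ := (hP M w.1).1 w.2
    have h1 := hp M w
    have h2 := hq M w
    simp [hw] at h1 h2
    rw [← Subtype.ext h1, ← Subtype.ext h2]
    exact ⟨hw, he⟩
  refine ⟨of P h, p, q, isPullback_map_of_bijective ?_ ?_ ?_⟩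
  · exact hom_ext fun M w => by rw [eval_comp, eval_comp, (key M w).2]
  · intro M w w' h1 h2
    exact Subtype.ext (by rw [(key M w).1, (key M w').1, h1, h2])
  · intro M x y he
    let w : (of P h).Pts M := ⟨opair x.1 y.1, (hP M _).2 ⟨x, y, rfl, he⟩⟩
    have := opair_eq_opair_iff.1 (key M w).1
    exact ⟨w, Subtype.ext this.1.symm, Subtype.ext this.2.symm⟩

theorem hasFiniteLimits : HasFiniteLimits DST := by
  have := (isTerminal_emptyF isDefinableSet_emptyF).some.hasTerminal
  have (X Y B : DST) (f : X ⟶ B) (g : Y ⟶ B) : HasLimit (cospan f g) := by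
    obtain ⟨W, p, q, h⟩ := exists_pullback f g
    exact (IsPullback.of_map_of_faithful inclusion h).hasPullback
  have := hasPullbacks_of_hasLimit_cospan DST
  exact hasFiniteLimits_of_hasTerminal_and_pullbacks

/-- A terminal object and pullbacks generate all finite limits. For each of these shapes it is
enough to exhibit one limit cone whose image is a limit cone. -/
theorem preservesFiniteLimits : PreservesFiniteLimits inclusion := by
  have := hasFiniteLimits
  have : PreservesLimit (Functor.empty.{0} DST) inclusion :=
    preservesLimit_of_preserves_limit_cone (isTerminal_emptyF isDefinableSet_emptyF).some
      ((isLimitMapConeEmptyConeEquiv _ _).symm (isTerminal_map_emptyF isDefinableSet_emptyF).some)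
  have : PreservesLimitsOfShape (Discrete.{0} PEmpty) inclusion :=
    preservesLimitsOfShape_pempty_of_preservesTerminal inclusion
  have : PreservesLimitsOfShape WalkingCospan inclusion := ⟨fun {K} => by
    obtain ⟨W, p, q, h⟩ := exists_pullback (K.map WalkingCospan.Hom.inl) (K.map WalkingCospan.Hom.inr)
    have h' := IsPullback.of_map_of_faithful inclusion h
    have := preservesLimit_of_preserves_limit_cone h'.isLimit
      ((isLimitMapConePullbackConeEquiv inclusion h'.w).symm h.isLimit)
    exact preservesLimit_of_iso_diagram inclusion (diagramIsoCospan K).symm⟩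
  exact preservesFiniteLimits_of_preservesTerminal_and_pullbacks inclusion

/-! ### Binary products -/

theorem exists_projections (X Y : DST) (h : IsDefinableSet (prodFml X.fml Y.fml)) :
    ∃ (p : of (prodFml X.fml Y.fml) h ⟶ X) (q : of (prodFml X.fml Y.fml) h ⟶ Y),
      IsClassOf p (fstFml X.fml Y.fml) ∧ IsClassOf q (sndFml X.fml Y.fml) ∧
      ∀ (M : Mod ZF) (w : (of (prodFml X.fml Y.fml) h).Pts M),
        w.1 = opair (eval p w).1 (eval q w).1 := by
  have h1 (M : Mod ZF) (a b : M) : Sat (fstFml X.fml Y.fml) ![a, b] ↔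
      ∃ x y, a = opair x y ∧ Sat X.fml ![x] ∧ Sat Y.fml ![y] ∧ b = x := by
    simp [fstFml, comp_vec_one, and_assoc]
  have h2 (M : Mod ZF) (a b : M) : Sat (sndFml X.fml Y.fml) ![a, b] ↔
      ∃ x y, a = opair x y ∧ Sat X.fml ![x] ∧ Sat Y.fml ![y] ∧ b = y := by
    simp [sndFml, comp_vec_one, and_assoc]
  obtain ⟨p, hp, hp'⟩ := exists_isClassOf (X := of (prodFml X.fml Y.fml) h) (Y := X)
    (fstFml X.fml Y.fml) (fun M a b hab => by
      obtain ⟨x, y, rfl, hx, hy, rfl⟩ := (h1 M a b).1 hab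
      exact ⟨(sat_prodFml _ _ _).2 ⟨_, _, rfl, hx, hy⟩, hx⟩) (fun M a ha => by
      obtain ⟨x, y, ha, hx, hy⟩ := (sat_prodFml _ _ _).1 ha
      obtain rfl : a = opair x y := ha
      refine ⟨x, (h1 _ _ _).2 ⟨x, y, rfl, hx, hy, rfl⟩, fun b hb => ?_⟩
      obtain ⟨x', y', e, -, -, rfl⟩ := (h1 _ _ _).1 hb
      exact (opair_eq_opair_iff.1 e).1.symm)
  obtain ⟨q, hq, hq'⟩ := exists_isClassOf (X := of (prodFml X.fml Y.fml) h) (Y := Y)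
    (sndFml X.fml Y.fml) (fun M a b hab => by
      obtain ⟨x, y, rfl, hx, hy, rfl⟩ := (h2 M a b).1 hab
      exact ⟨(sat_prodFml _ _ _).2 ⟨_, _, rfl, hx, hy⟩, hy⟩) (fun M a ha => by
      obtain ⟨x, y, ha, hx, hy⟩ := (sat_prodFml _ _ _).1 ha
      obtain rfl : a = opair x y := ha
      refine ⟨y, (h2 _ _ _).2 ⟨x, y, rfl, hx, hy, rfl⟩, fun b hb => ?_⟩
      obtain ⟨x', y', e, -, -, rfl⟩ := (h2 _ _ _).1 hb
      exact (opair_eq_opair_iff.1 e).2.symm)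
  refine ⟨p, q, hp, hq, fun M w => ?_⟩
  obtain ⟨x, y, e, -, -, e1⟩ := (h1 _ _ _).1 (hp' M w)
  obtain ⟨x', y', e', -, -, e2⟩ := (h2 _ _ _).1 (hq' M w)
  rw [e1, e2, e, opair_eq_opair_iff]
  exact ⟨rfl, (opair_eq_opair_iff.1 (e.symm.trans e')).2⟩

theorem isProduct_of_opair {X Y : DST} {h : IsDefinableSet (prodFml X.fml Y.fml)}
    {p : of (prodFml X.fml Y.fml) h ⟶ X} {q : of (prodFml X.fml Y.fml) h ⟶ Y}
    (hpq : ∀ (M : Mod ZF) (w : (of (prodFml X.fml Y.fml) h).Pts M),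
      w.1 = opair (eval p w).1 (eval q w).1) : IsProduct p q := by
  refine isProduct_of_map (isProduct_map_of_bijective (fun M w w' h1 h2 => ?_) fun M x y => ?_)
  · exact Subtype.ext (by rw [hpq M w, hpq M w', h1, h2])
  · let w : (of (prodFml X.fml Y.fml) h).Pts M :=
      ⟨opair x.1 y.1, (sat_prodFml _ _ _).2 ⟨_, _, rfl, x.2, y.2⟩⟩
    have := opair_eq_opair_iff.1 (hpq M w)
    exact ⟨w, Subtype.ext this.1.symm, Subtype.ext this.2.symm⟩

/-- An element of a product of definable sets is a pair of elements of the factors. -/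
theorem bijective_of_isProduct {V X Y : DST} {r : V ⟶ X} {s : V ⟶ Y} (h : IsProduct r s)
    {M : Mod ZF} : Function.Bijective fun v : V.Pts M => (eval r v, eval s v) := by
  have hd := isDefinableSet_prodFml X.property Y.property
  obtain ⟨p, q, -, -, hpq⟩ := exists_projections X Y hd
  -- The product is compared with the concrete one, whose elements are literally ordered pairs;
  -- isomorphisms are bijective on points.
  let e := h.some.conePointUniqueUpToIso (isProduct_of_opair hpq).some
  have hp : e.hom ≫ p = r :=
    IsLimit.conePointUniqueUpToIso_hom_comp h.some (isProduct_of_opair hpq).some ⟨.left⟩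
  have hq : e.hom ≫ q = s :=
    IsLimit.conePointUniqueUpToIso_hom_comp h.some (isProduct_of_opair hpq).some ⟨.right⟩
  constructor
  · intro v v' hv
    rw [← hp, ← hq] at hv
    simp only [eval_comp, Prod.mk.injEq] at hv
    have := congrArg (eval e.inv) (Subtype.ext (show (eval e.hom v).1 = (eval e.hom v').1 by
      rw [hpq M (eval e.hom v), hpq M (eval e.hom v'), hv.1, hv.2]))
    rwa [← eval_comp, ← eval_comp, e.hom_inv_id, eval_id, eval_id] at this
  · rintro ⟨x, y⟩
    let w : (of (prodFml X.fml Y.fml) hd).Pts M :=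
      ⟨opair x.1 y.1, (sat_prodFml _ _ _).2 ⟨_, _, rfl, x.2, y.2⟩⟩
    have := opair_eq_opair_iff.1 (hpq M w)
    refine ⟨eval e.inv w, Prod.ext ?_ ?_⟩
    · change eval r _ = _
      rw [← hp, ← eval_comp, e.inv_hom_id_assoc]
      exact Subtype.ext this.1.symm
    · change eval s _ = _
      rw [← hq, ← eval_comp, e.inv_hom_id_assoc]
      exact Subtype.ext this.2.symm

end DST

/-! ### The subobject classifier -/

namespace SynCat

/-- An arrow to the class `{0, 1}` classifies the monomorphism `m` if and only if, in every model,
it takes the value `1` exactly on the image of `m`. -/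
theorem isPullback_truth_iff {t : (⟨1, emptyF⟩ : SynCat ZF) ⟶ ⟨1, omegaFml⟩}
    (ht : ∀ (M : Mod ZF) x, Sat oneF (eval t (M := M) x).1) {U X : SynCat ZF} (m : U ⟶ X) [Mono m]
    (χ : X ⟶ ⟨1, omegaFml⟩) : (∃ u, IsPullback m u χ t) ↔
      ∀ (M : Mod ZF) (x : X.Pts M), Sat oneF (eval χ x).1 ↔ ∃ u : U.Pts M, eval m u = x := by
  have hI := (DST.isTerminal_map_emptyF isDefinableSet_emptyF).some
  constructor
  · rintro ⟨u, hu⟩ M x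
    constructor
    · intro hx
      obtain ⟨G, hG⟩ := exists_formula χ
      -- Z is the part of X where χ takes the value 1. Its inclusion into X equalises χ with the
      -- constant 1, so it factors through the pullback U, and the factorisation at x is the
      -- preimage sought.
      let Z : SynCat ZF := ⟨X.arity, X.formula ⊓ exN 1 (G ⊓ ren (Fin.natAdd X.arity) oneF)⟩
      have hZ (M : Mod ZF) (x : Fin X.arity → M) :
          Sat Z.formula x ↔ ∃ h, Sat oneF (eval χ ⟨x, h⟩).1 := by
        simp only [Z, sat_and, sat_exN, hG, sat_ren, fin_append_comp_natAdd]
        constructor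
        · rintro ⟨h, y, ⟨_, rfl⟩, h'⟩
          exact ⟨h, h'⟩
        · rintro ⟨h, h'⟩
          exact ⟨h, _, ⟨h, rfl⟩, h'⟩
      obtain ⟨k, hk⟩ := exists_hom_of_existsUnique (X := Z) (Y := X)
        (eqs (Fin.castAdd X.arity) (Fin.natAdd X.arity)) fun M z => by
          refine ⟨⟨z.1, ((hZ M _).1 z.2).1⟩, ?_, fun y hy => ?_⟩
          · exact (sat_eqs _ _ _).2
              ((fin_append_comp_castAdd z.1 z.1).trans (fin_append_comp_natAdd z.1 z.1).symm)
          · exact Subtype.ext (((fin_append_comp_castAdd z.1 y.1).symm.trans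
              (((sat_eqs _ _ _).1 hy).trans (fin_append_comp_natAdd z.1 y.1))).symm)
      have hk (M : Mod ZF) (z : Z.Pts M) : eval k z = ⟨z.1, ((hZ M _).1 z.2).1⟩ :=
        Subtype.ext ((fin_append_comp_castAdd z.1 _).symm.trans
          (((sat_eqs _ _ _).1 (hk M z)).trans (fin_append_comp_natAdd z.1 _))).symm
      have w : k ≫ χ = hI.from Z ≫ t := hom_ext fun M z => by
        rw [eval_comp, eval_comp, hk]
        have h1 := ((hZ M _).1 z.2).2
        have h2 := ht M (eval (hI.from Z) z)
        rw [sat_oneF] at h1 h2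
        refine Subtype.ext ?_
        rw [eq_vec_one (eval χ _).1, eq_vec_one (eval t _).1, h1, h2]
      let z : Z.Pts M := ⟨x.1, (hZ M _).2 ⟨x.2, hx⟩⟩
      refine ⟨eval (hu.lift k _ w) z, ?_⟩
      rw [← eval_comp, hu.lift_fst, hk]
    · rintro ⟨u', rfl⟩
      rw [← eval_comp, hu.w, eval_comp]
      exact ht M _
  · intro h
    refine ⟨hI.from U, isPullback_of_bijective ?_ (fun M w w' h _ => eval_injective_of_mono m h) ?_⟩
    · refine hom_ext fun M u => ?_
      have h1 := (h M _).2 ⟨u, rfl⟩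
      have h2 := ht M (eval (hI.from U) u)
      rw [sat_oneF] at h1 h2
      refine Subtype.ext ?_
      rw [eval_comp, eval_comp, eq_vec_one (eval χ _).1, eq_vec_one (eval t _).1, h1, h2]
    · intro M x y he
      -- Since t only takes the value 1, x lies in the image of m; the other component agrees
      -- because the domain of t has a single point.
      obtain ⟨u, rfl⟩ := (h M x).1 (he ▸ ht M y)
      refine ⟨u, rfl, Subtype.ext ?_⟩
      have h1 := (sat_emptyF _).1 y.2
      have h2 := (sat_emptyF _).1 (eval (hI.from U) u).2
      rw [eq_vec_one y.1, h1]
      exact (eq_vec_one _).trans (congrArg (fun c => ![c]) h2)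

/-- A map into {0, 1} is determined by where it equals 1, which `isPullback_truth_iff` identifies as
the image of m. The characteristic function exists because membership in that image is a formula,
even when U and X have contexts of any length. -/
theorem isSubobjectClassifier {t : (⟨1, emptyF⟩ : SynCat ZF) ⟶ ⟨1, omegaFml⟩}
    (ht : ∀ (M : Mod ZF) x, Sat oneF (eval t (M := M) x).1) : IsSubobjectClassifier t := by
  refine ⟨DST.isTerminal_map_emptyF isDefinableSet_emptyF, fun U X m _ => ?_⟩
  obtain ⟨F, hF⟩ := exists_formula m
  have hP (M : Mod ZF) (x : Fin X.arity → M) (y : Fin 1 → M) :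
      Sat (exN U.arity (ren (Fin.append (Fin.natAdd _) (Fin.castAdd _ ∘ Fin.castAdd _)) F))
        (Fin.append x y) ↔ ∃ u : U.Pts M, (eval m u).1 = x := by
    simp only [sat_exN, sat_ren, comp_fin_append, ← Function.comp_assoc,
      fin_append_comp_castAdd, fin_append_comp_natAdd, hF]
    exact ⟨fun ⟨u, h, h'⟩ => ⟨⟨u, h⟩, h'⟩, fun ⟨u, h⟩ => ⟨u.1, u.2, h⟩⟩
  -- The last variable, the truth value, does not occur in this formula for the image of m; it is
  -- present so that the graph of χ can be written as an equivalence.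
  set P : Fml (X.arity + 1) :=
    exN U.arity (ren (Fin.append (Fin.natAdd _) (Fin.castAdd _ ∘ Fin.castAdd _)) F)
  obtain ⟨χ, hχ⟩ := exists_hom_of_existsUnique (X := X) (Y := ⟨1, omegaFml⟩)
    ((P ⇔ ren (Fin.natAdd X.arity) oneF) : Fml (X.arity + 1)) fun M x => by
      simp only [sat_iff, hP, sat_ren, fin_append_comp_natAdd, sat_oneF]
      by_cases hx : ∃ u : U.Pts M, (eval m u).1 = x.1
      · refine ⟨⟨![one M], by simp [omegaFml]⟩, by simpa using hx, fun y hy => Subtype.ext ?_⟩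
        exact (eq_vec_one _).trans (congrArg (fun c => ![c]) (hy.1 hx))
      · refine ⟨⟨![empty M], by simp [omegaFml]⟩, by simpa [one_ne_empty.symm] using hx,
          fun y hy => Subtype.ext ?_⟩
        have h1 : y.1 (0 : Fin 1) = empty M ∨ y.1 (0 : Fin 1) = one M := by
          have := y.2
          simpa [omegaFml] using this
        exact (eq_vec_one _).trans (congrArg (fun c => ![c])
          (h1.resolve_right fun h => hx (hy.2 h)))
  have hχ (M : Mod ZF) (x : X.Pts M) : Sat oneF (eval χ x).1 ↔ ∃ u : U.Pts M, eval m u = x := by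
    have := hχ M x
    simp only [sat_iff, hP, sat_ren, fin_append_comp_natAdd] at this
    exact this.symm.trans (exists_congr fun u => Subtype.ext_iff.symm)
  refine ⟨χ, (isPullback_truth_iff ht m χ).2 hχ, fun χ' h => hom_ext fun M x => ?_⟩
  have h' := ((isPullback_truth_iff ht m χ').1 h M x).trans (hχ M x).symm
  have h1 := (eval χ' x).2
  have h2 := (eval χ x).2
  refine Subtype.ext ((eq_vec_one _).trans (.trans (congrArg (fun c => ![c]) ?_)
    (eq_vec_one _).symm))
  simp only [omegaFml, sat_or, sat_emptyF, sat_oneF] at h' h1 h2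
  rcases h1 with h1 | h1
  · refine h1.trans (h2.resolve_right fun h2 => ?_).symm
    exact one_ne_empty ((h'.2 h2).symm.trans h1)
  · exact h1.trans (h'.1 h1).symm

end SynCat

namespace DST

theorem exists_truth (h₀ : IsDefinableSet emptyF) (h : IsDefinableSet omegaFml) :
    ∃ t : of emptyF h₀ ⟶ of omegaFml h, IsClassOf t truthFml ∧
      ∀ (M : Mod ZF) (x : (inclusion.obj (of emptyF h₀)).Pts M),
        Sat oneF (SynCat.eval (inclusion.map t) x).1 := by
  have ht (M : Mod ZF) (a b : M) : Sat truthFml ![a, b] ↔ a = empty M ∧ b = one M := by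
    simp [truthFml]
  obtain ⟨t, h1, h2⟩ := exists_isClassOf (X := of emptyF h₀) (Y := of omegaFml h) truthFml
    (fun M a b hab => by
      obtain ⟨rfl, rfl⟩ := (ht M a b).1 hab
      exact ⟨(sat_emptyF _).2 rfl, (sat_or _ _ _).2 (Or.inr ((sat_oneF _).2 rfl))⟩) (fun M a ha => by
      obtain rfl : a = empty M := (sat_emptyF _).1 ha
      simp [ht])
  refine ⟨t, h1, fun M x => ?_⟩
  obtain ⟨x, rfl⟩ := (ptsEquiv _ M).surjective x
  rw [eval_ptsEquiv]
  exact (sat_oneF _).2 ((ht _ _ _).1 (h2 M x)).2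

/-- A monomorphism of definable sets stays one in the syntactic category, as finite limits are
preserved. Fullness brings its classifying arrow back, and pullback squares transfer in both
directions. -/
theorem isSubobjectClassifier_of_map {I Ω : DST} {t : I ⟶ Ω}
    (h : IsSubobjectClassifier (inclusion.map t)) : IsSubobjectClassifier t := by
  have := preservesFiniteLimits
  refine ⟨h.1.map fun h => h.isTerminalOfObj inclusion _, fun U X m _ => ?_⟩
  obtain ⟨χ, ⟨u, hu⟩, hχ⟩ := h.2 (inclusion.map m) inferInstance
  obtain ⟨χ, rfl⟩ := inclusion.map_surjective χ
  obtain ⟨u, rfl⟩ := inclusion.map_surjective u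
  refine ⟨χ, ⟨u, IsPullback.of_map_of_faithful inclusion hu⟩, ?_⟩
  rintro χ' ⟨u', hu'⟩
  exact inclusion.map_injective (hχ _ ⟨_, hu'.map inclusion⟩)

end DST

theorem hasSubobjectClassifier_of_isSubobjectClassifier {C : Type*} [Category C] {I Ω : C}
    {t : I ⟶ Ω} (h : IsSubobjectClassifier t) : HasSubobjectClassifier C := by
  choose χ hχ hu using fun (U X : C) (m : U ⟶ X) (hm : Mono m) => h.2 m hm
  exact ⟨⟨.mkOfTerminalΩ₀ I h.1.some Ω t (fun m hm => χ _ _ m hm) (fun m hm => by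
    obtain ⟨u, hu⟩ := hχ _ _ m hm
    rwa [h.1.some.hom_ext u (h.1.some.from _)] at hu) fun m hm χ' hχ' => hu _ _ m hm χ' ⟨_, hχ'⟩⟩⟩

/-! ### Exponentials -/

namespace DST

/-- A function in the exponential is total on X and single-valued, so the value at x exists and is
unique. -/
theorem exists_eval (X Y : DST)
    (h' : IsDefinableSet (prodFml (expFml X.fml Y.fml) X.fml)) :
    ∃ ev : of (prodFml (expFml X.fml Y.fml) X.fml) h' ⟶ Y, IsClassOf ev (evalFml X.fml Y.fml) ∧
      ∀ (M : Mod ZF) (w : (of (prodFml (expFml X.fml Y.fml) X.fml) h').Pts M) (f x : M),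
        w.1 = opair f x → Mem (opair x (eval ev w).1) f := by
  have he (M : Mod ZF) (a b : M) : Sat (evalFml X.fml Y.fml) ![a, b] ↔
      ∃ f x, a = opair f x ∧ Sat (expFml X.fml Y.fml) ![f] ∧ Mem (opair x b) f := by
    simp only [evalFml, sat_ex, sat_and, sat_ren, sat_pairF, sat_pairMemF, comp_vec_one, and_assoc]
    rfl
  obtain ⟨ev, h1, h2⟩ := exists_isClassOf (X := of (prodFml (expFml X.fml Y.fml) X.fml) h') (Y := Y)
    (evalFml X.fml Y.fml) (fun M a b hab => by
      obtain ⟨f, x, rfl, hf, hb⟩ := (he M a b).1 hab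
      obtain ⟨-, hf2, hf3⟩ := (sat_expFml _ _ _).1 hf
      exact ⟨(sat_prodFml _ _ _).2 ⟨f, x, rfl, hf, (hf2 x).1 ⟨b, hb⟩⟩, hf3 b ⟨x, hb⟩⟩)
    (fun M a ha => by
      obtain ⟨f, x, ha, hf, hx⟩ := (sat_prodFml _ _ _).1 ha
      obtain rfl : a = opair f x := ha
      obtain ⟨⟨-, hf1⟩, hf2, -⟩ := (sat_expFml _ _ _).1 hf
      obtain ⟨y, hy⟩ := (hf2 x).2 hx
      refine ⟨y, (he _ _ _).2 ⟨f, x, rfl, hf, hy⟩, fun y' hy' => ?_⟩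
      obtain ⟨f', x', e, -, hy'⟩ := (he _ _ _).1 hy'
      obtain ⟨rfl, rfl⟩ := opair_eq_opair_iff.1 e
      exact hf1 _ _ _ hy' hy)
  refine ⟨ev, h1, fun M w f x hw => ?_⟩
  obtain ⟨f', x', e, -, hm⟩ := (he _ _ _).1 (h2 M w)
  obtain ⟨rfl, rfl⟩ := opair_eq_opair_iff.1 (hw.symm.trans e)
  exact hm

/-- The condition on a transpose g' amounts to ⟨s v, g v⟩ ∈ g'(r v) for all v (`key1`). As V is a
product of Z and X, this pins down the elements of every g'(z) (`key2`), which gives uniqueness by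
extensionality and also tells which set to take for existence. -/
theorem isExponential {X Y : DST} {h : IsDefinableSet (expFml X.fml Y.fml)}
    {h' : IsDefinableSet (prodFml (expFml X.fml Y.fml) X.fml)}
    {p : of (prodFml (expFml X.fml Y.fml) X.fml) h' ⟶ of (expFml X.fml Y.fml) h}
    {q : of (prodFml (expFml X.fml Y.fml) X.fml) h' ⟶ X}
    {ev : of (prodFml (expFml X.fml Y.fml) X.fml) h' ⟶ Y}
    (hpq : ∀ (M : Mod ZF) (w : (of (prodFml (expFml X.fml Y.fml) X.fml) h').Pts M),
      w.1 = opair (eval p w).1 (eval q w).1)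
    (hev : ∀ (M : Mod ZF) (w : (of (prodFml (expFml X.fml Y.fml) X.fml) h').Pts M) (f x : M),
        w.1 = opair f x → Mem (opair x (eval ev w).1) f) :
    IsExponential p q ev := by
  have hp : IsProduct p q := isProduct_of_opair (X := of (expFml X.fml Y.fml) h) hpq
  refine ⟨hp, fun Z V r s hrs g => ?_⟩
  -- an element of the exponential, as a function
  have hE (M : Mod ZF) (f : (of (expFml X.fml Y.fml) h).Pts M) := (sat_expFml _ _ _).1 f.2
  have key1 (g' : Z ⟶ of (expFml X.fml Y.fml) h) :
      (∃ k : V ⟶ _, k ≫ p = r ≫ g' ∧ k ≫ q = s ∧ k ≫ ev = g) ↔ ∀ (M : Mod ZF) (v : V.Pts M),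
        Mem (opair (eval s v).1 (eval g v).1) (eval g' (eval r v)).1 := by
    constructor
    · rintro ⟨k, hk1, rfl, rfl⟩ M v
      rw [← eval_comp, ← hk1]
      simp only [eval_comp]
      exact hev M _ _ _ (hpq M _)
    · intro hg
      obtain ⟨k, hk1, hk2⟩ : ∃ k : V ⟶ of _ h', k ≫ p = r ≫ g' ∧ k ≫ q = s :=
        let l := BinaryFan.IsLimit.lift' hp.some (r ≫ g') s
        ⟨l.1, l.2.1, l.2.2⟩
      refine ⟨k, hk1, hk2, hom_ext fun M v => Subtype.ext ?_⟩
      have h1 := hev M (eval k v) _ _ (hpq M _)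
      have h2 := hg M v
      rw [← eval_comp k p, ← eval_comp k q, ← eval_comp k ev, hk1, hk2, eval_comp r g'] at h1
      -- Both the evaluation at `k v` and g(v) are values of the same single-valued set at s(v).
      exact (hE M _).1.2 _ _ _ h1 h2
  have key2 (g' : Z ⟶ of (expFml X.fml Y.fml) h)
      (hg : ∀ (M : Mod ZF) (v : V.Pts M),
        Mem (opair (eval s v).1 (eval g v).1) (eval g' (eval r v)).1)
      (M : Mod ZF) (z : Z.Pts M) (t : M) : Mem t (eval g' z).1 ↔
        ∃ v : V.Pts M, eval r v = z ∧ t = opair (eval s v).1 (eval g v).1 := by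
    constructor
    · intro ht
      obtain ⟨⟨h1, h2⟩, h3, -⟩ := hE M (eval g' z)
      obtain ⟨x, y, rfl⟩ := h1 t ht
      have hx := (h3 x).1 ⟨y, ht⟩
      -- The argument x and the parameter z come from one point v of the product, and
      -- single-valuedness forces y = g(v).
      obtain ⟨v, hv⟩ := (bijective_of_isProduct hrs).2 (z, (⟨x, hx⟩ : X.Pts M))
      obtain ⟨rfl, hv2⟩ := Prod.ext_iff.1 hv
      have hv2 : (eval s v).1 = x := congrArg Subtype.val hv2
      subst hv2
      exact ⟨v, rfl, by rw [h2 _ _ _ ht (hg M v)]⟩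
    · rintro ⟨v, rfl, rfl⟩
      exact hg M v
  obtain ⟨R, hR⟩ := exists_formula r
  obtain ⟨S, hS⟩ := exists_formula s
  obtain ⟨G, hG⟩ := exists_formula g
  -- The variables are z, t, v, x, y in this order: x = s(v) and y = g(v) for some v over z, and t =
  -- ⟨x, y⟩.
  let ψ : Fml 2 := ∃' ∃' ∃' (ren ![2, 0] R ⊓ ren ![2, 3] S ⊓ ren ![2, 4] G ⊓ ren ![1, 3, 4] pairF)
  have hψ (M : Mod ZF) (z : Z.Pts M) (t : M) : Sat ψ ![z.1, t] ↔
      ∃ v : V.Pts M, eval r v = z ∧ t = opair (eval s v).1 (eval g v).1 := by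
    simp only [ψ, sat_ex, sat_and, sat_ren, sat_pairF, comp_vec_two, hR, hS, hG]
    constructor
    · rintro ⟨v, x, y, ⟨⟨⟨hv, h1⟩, ⟨_, h2⟩⟩, ⟨_, h3⟩⟩, ht⟩
      exact ⟨⟨v, hv⟩, Subtype.ext h1, ht.trans (congrArg₂ opair h2.symm h3.symm)⟩
    · rintro ⟨v, h1, ht⟩
      exact ⟨v.1, _, _, ⟨⟨⟨v.2, congrArg Subtype.val h1⟩, ⟨v.2, rfl⟩⟩, ⟨v.2, rfl⟩⟩, ht⟩
  have hset (M : Mod ZF) (z : Z.Pts M) : ∃ f : M, ∀ t, Mem t f ↔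
      ∃ v : V.Pts M, eval r v = z ∧ t = opair (eval s v).1 (eval g v).1 := by
    obtain ⟨a, ha⟩ := isDefinableSet_iff.1 (isDefinableSet_prodFml X.property Y.property) M
    have e (t : M) : (Fin.snoc ![z.1] t : Fin 2 → M) = ![z.1, t] := by
      funext i
      fin_cases i <;> rfl
    obtain ⟨f, hf⟩ := exists_set_of_bounded ψ ![z.1] (a := a) fun t ht => by
      rw [e, hψ] at ht
      obtain ⟨v, -, rfl⟩ := ht
      exact (ha _).2 ((sat_prodFml _ _ _).2 ⟨_, _, rfl, (eval s v).2, (eval g v).2⟩)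
    exact ⟨f, fun t => (hf t).trans (by rw [e, hψ])⟩
  have hF (M : Mod ZF) (z : Z.Pts M) (f : M) : Sat (∀' (memF 2 1 ⇔ ren ![0, 2] ψ)) ![z.1, f] ↔
      ∀ t, Mem t f ↔ ∃ v : V.Pts M, eval r v = z ∧ t = opair (eval s v).1 (eval g v).1 := by
    simp only [sat_all, sat_iff, sat_memF, sat_ren, comp_vec_two]
    exact forall_congr' fun t => iff_congr Iff.rfl (hψ M z t)
  obtain ⟨g', hg'⟩ := exists_hom (X := Z) (Y := of (expFml X.fml Y.fml) h)
    (∀' (memF 2 1 ⇔ ren ![0, 2] ψ)) fun M z => by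
      -- That f is a function from X to Y uses both halves of v ↦ (r v, s v) being bijective:
      -- injectivity makes it single-valued and surjectivity makes it total.
      obtain ⟨f, hf⟩ := hset M z
      refine ⟨⟨f, (sat_expFml _ _ _).2 ⟨⟨fun t ht => ?_, fun x y y' hy hy' => ?_⟩, fun x => ?_,
        fun y => ?_⟩⟩, (hF M z f).2 hf, fun f' hf' => ?_⟩
      · obtain ⟨v, -, rfl⟩ := (hf t).1 ht
        exact ⟨_, _, rfl⟩
      · obtain ⟨v, hv, e⟩ := (hf _).1 hy
        obtain ⟨v', hv', e'⟩ := (hf _).1 hy'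
        rw [opair_eq_opair_iff] at e e'
        have : v = v' := (bijective_of_isProduct hrs).1 (Prod.ext (hv.trans hv'.symm)
          (Subtype.ext (e.1.symm.trans e'.1)))
        rw [e.2, e'.2, this]
      · constructor
        · rintro ⟨y, hy⟩
          obtain ⟨v, -, e⟩ := (hf _).1 hy
          rw [(opair_eq_opair_iff.1 e).1]
          exact (eval s v).2
        · intro hx
          obtain ⟨v, hv⟩ := (bijective_of_isProduct hrs).2 (z, (⟨x, hx⟩ : X.Pts M))
          obtain ⟨hv1, hv2⟩ := Prod.ext_iff.1 hv
          exact ⟨_, (hf _).2 ⟨v, hv1, congrArg (opair · _) (congrArg Subtype.val hv2).symm⟩⟩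
      · rintro ⟨x, hy⟩
        obtain ⟨v, -, e⟩ := (hf _).1 hy
        rw [(opair_eq_opair_iff.1 e).2]
        exact (eval g v).2
      · exact Subtype.ext (mem_ext fun t => ((hF M z _).1 hf' t).trans (hf t).symm)
  have hg (M : Mod ZF) (v : V.Pts M) :
      Mem (opair (eval s v).1 (eval g v).1) (eval g' (eval r v)).1 :=
    ((hF M _ _).1 (hg' M (eval r v)) _).2 ⟨v, rfl, rfl⟩
  refine ⟨g', (key1 g').2 hg, fun g'' hg'' => hom_ext fun M z => Subtype.ext (mem_ext fun t => ?_)⟩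
  rw [key2 g'' ((key1 g'').1 hg''), key2 g' hg]

end DST

/-! ### From exponential objects to a closed structure -/

section Closed

variable {C : Type*} [Category C]

open MonoidalCategory CartesianMonoidalCategory

/-- A cartesian monoidal category with exponentials is closed. -/
theorem monoidalClosed_of_isExponential [CartesianMonoidalCategory C]
    (h : ∀ X Y : C, ∃ (E W : C) (p : W ⟶ E) (q : W ⟶ X) (ev : W ⟶ Y), IsExponential p q ev) :
    Nonempty (MonoidalClosed C) := by
  refine ⟨⟨fun X => ?_⟩⟩
  choose E W p q ev hE using h X
  -- The functor `tensorLeft X` puts X on the left, while `IsExponential` lists the projection to Z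
  -- first.
  have hp (Z : C) : IsProduct (snd X Z) (fst X Z) :=
    ⟨BinaryFan.isLimitFlip (tensorProductIsBinaryProduct X Z)⟩
  choose τ k hk1 hk2 hk3 using fun (Z Y : C) (g : X ⊗ Z ⟶ Y) => ((hE Y).2 _ _ (hp Z) g).exists
  have hτ {Z Y : C} {g : X ⊗ Z ⟶ Y} {g' : Z ⟶ E Y} (k' : X ⊗ Z ⟶ W Y)
      (h1 : k' ≫ p Y = snd X Z ≫ g') (h2 : k' ≫ q Y = fst X Z) (h3 : k' ≫ ev Y = g) :
      τ Z Y g = g' :=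
    ((hE Y).2 _ _ (hp Z) g).unique ⟨_, hk1 Z Y g, hk2 Z Y g, hk3 Z Y g⟩ ⟨k', h1, h2, h3⟩
  let l (Z Y : C) (g' : Z ⟶ E Y) := BinaryFan.IsLimit.lift' (hE Y).1.some (snd X Z ≫ g') (fst X Z)
  have hl1 (Z Y : C) (g' : Z ⟶ E Y) : (l Z Y g').1 ≫ p Y = snd X Z ≫ g' := (l Z Y g').2.1
  have hl2 (Z Y : C) (g' : Z ⟶ E Y) : (l Z Y g').1 ≫ q Y = fst X Z := (l Z Y g').2.2
  let e (Z Y : C) : ((tensorLeft X).obj Z ⟶ Y) ≃ (Z ⟶ E Y) :=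
    { toFun := τ Z Y
      invFun := fun g' => (l Z Y g').1 ≫ ev Y
      left_inv := fun g => by
        have : (l Z Y (τ Z Y g)).1 = k Z Y g := BinaryFan.IsLimit.hom_ext (hE Y).1.some
          ((hl1 _ _ _).trans (hk1 _ _ _).symm) ((hl2 _ _ _).trans (hk2 _ _ _).symm)
        exact (congrArg (· ≫ ev Y) this).trans (hk3 Z Y g)
      right_inv := fun g' => hτ _ (hl1 Z Y g') (hl2 Z Y g') rfl }
  -- A bijection natural in Z is all that is needed; the right adjoint's action on arrows is built
  -- from it. For naturality, uniqueness of transposes reduces the claim to the witness `X ◁ f ≫ k Z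
  -- Y g`.
  exact ⟨_, Adjunction.adjunctionOfEquivRight e fun Z' Z Y f g => hτ (X ◁ f ≫ k Z Y g)
    (by rw [Category.assoc, hk1, whiskerLeft_snd_assoc]; rfl)
    (by rw [Category.assoc, hk2, whiskerLeft_fst])
    (by rw [Category.assoc, hk3]; rfl)⟩

end Closed

/-! ### The topos of definable sets -/

namespace DST

theorem isElementaryTopos : IsElementaryTopos DST where
  hasFiniteLimits := hasFiniteLimits
  cartesianClosed := by
    have := hasFiniteLimits
    let _ : CartesianMonoidalCategory DST := .ofHasFiniteProducts
    refine ⟨inferInstance, monoidalClosed_of_isExponential fun X Y => ?_⟩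
    have h := isDefinableSet_expFml X.property Y.property
    obtain ⟨p, q, -, -, hpq⟩ :=
      exists_projections (of _ h) X (isDefinableSet_prodFml h X.property)
    obtain ⟨ev, -, hev⟩ := exists_eval X Y (isDefinableSet_prodFml h X.property)
    exact ⟨_, _, p, q, ev, isExponential hpq hev⟩
  hasSubobjectClassifier := by
    obtain ⟨t, -, ht⟩ := exists_truth isDefinableSet_emptyF isDefinableSet_omegaFml
    exact hasSubobjectClassifier_of_isSubobjectClassifier
      (isSubobjectClassifier_of_map (SynCat.isSubobjectClassifier ht))

end DST

end DefinableSets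

theorem mainTheorem1 :
    IsElementaryTopos DST ∧
    -- finite limits are computed in the syntactic category
    PreservesFiniteLimits DST.inclusion ∧
    -- the terminal object
    (∃ h : IsDefinableSet emptyF, Nonempty (IsTerminal (DST.of emptyF h))) ∧
    -- binary products
    (∀ X Y : DST, ∃ (h : IsDefinableSet (prodFml X.fml Y.fml))
      (p : DST.of (prodFml X.fml Y.fml) h ⟶ X) (q : DST.of (prodFml X.fml Y.fml) h ⟶ Y),
      DST.IsClassOf p (fstFml X.fml Y.fml) ∧ DST.IsClassOf q (sndFml X.fml Y.fml) ∧
      IsProduct p q) ∧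
    -- the subobject classifier, in the definable sets and in the syntactic category
    (∃ (h₀ : IsDefinableSet emptyF) (h : IsDefinableSet omegaFml)
      (t : DST.of emptyF h₀ ⟶ DST.of omegaFml h),
      DST.IsClassOf t truthFml ∧ IsSubobjectClassifier t ∧
      IsSubobjectClassifier (DST.inclusion.map t)) ∧
    -- exponentials
    (∀ X Y : DST, ∃ (h : IsDefinableSet (expFml X.fml Y.fml))
      (h' : IsDefinableSet (prodFml (expFml X.fml Y.fml) X.fml))
      (p : DST.of (prodFml (expFml X.fml Y.fml) X.fml) h' ⟶ DST.of (expFml X.fml Y.fml) h)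
      (q : DST.of (prodFml (expFml X.fml Y.fml) X.fml) h' ⟶ X)
      (ev : DST.of (prodFml (expFml X.fml Y.fml) X.fml) h' ⟶ Y),
      DST.IsClassOf p (fstFml (expFml X.fml Y.fml) X.fml) ∧
      DST.IsClassOf q (sndFml (expFml X.fml Y.fml) X.fml) ∧
      DST.IsClassOf ev (evalFml X.fml Y.fml) ∧
      IsExponential p q ev) := by
  refine ⟨DST.isElementaryTopos, DST.preservesFiniteLimits,
    ⟨isDefinableSet_emptyF, DST.isTerminal_emptyF _⟩, fun X Y => ?_, ?_, fun X Y => ?_⟩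
  · have h := isDefinableSet_prodFml X.property Y.property
    obtain ⟨p, q, hp, hq, hpq⟩ := DST.exists_projections X Y h
    exact ⟨h, p, q, hp, hq, DST.isProduct_of_opair hpq⟩
  · obtain ⟨t, h, ht⟩ := DST.exists_truth isDefinableSet_emptyF isDefinableSet_omegaFml
    have hc : IsSubobjectClassifier (DST.inclusion.map t) := SynCat.isSubobjectClassifier ht
    exact ⟨_, _, t, h, DST.isSubobjectClassifier_of_map hc, hc⟩
  · have h := isDefinableSet_expFml X.property Y.property
    have h' := isDefinableSet_prodFml h X.property
    obtain ⟨p, q, hp, hq, hpq⟩ := DST.exists_projections (DST.of _ h) X h'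
    obtain ⟨ev, hev, hev'⟩ := DST.exists_eval X Y h'
    exact ⟨h, h', p, q, ev, hp, hq, hev, DST.isExponential hpq hev'⟩
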